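/- There are constants $C>0$ and $c\in\mathbb{N}$ and two fixed programs (a learner and a sampler) for a random access machine with bit costs (each elementary operation on natural numbers is charged for the bits it handles; multiplication and division are charged at the schoolbook rate) such that the following holds for every integer $n\ge 2$, every real $0<\epsilon\le 1$ and every $p=(p_1,\dots,p_n)\in[0,1]^n$. Let $f(x)=\sum_{i=1}^n x_i$, let $X=(X_1,\dots,X_n)$ have independent coordinates with $\Pr[X_i=1]=p_i=1-\Pr[X_i=0]$, and let $f(\bar p)$ denote the distribution of $f(X)$ on $\{0,1,\dots,n\}$. The learner is given $n$, $\lceil 1/\epsilon\rceil$ and access to independent samples from $f(\bar p)$. (1) Whatever the samples in $\{0,\dots,n\}$ are, the learner draws at most $C\log(n)\,(1/\epsilon)^c$ samples, performs at most $C\log^2(n)\,(1/\epsilon)^c$ bit operations, and outputs a succinct representation of a hypothesis distribution $\mathcal{H}$ over $\{0,1,\dots,n\}$, namely a histogram with at most $C\log(n)\,(1/\epsilon)^c$ intervals, given as the list of the lengths and the integer weights of consecutive intervals that partition $\{0,\dots,n\}$; $\mathcal H$ gives each interval a probability proportional to its weight and is uniform within each interval. (2) With probability at least $9/10$ over the samples,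 $$d_{\mathrm{TV}}(f(\bar p),\mathcal{H})=\tfrac12\sum_{j=0}^n\bigl|f(\bar p)(j)-\mathcal{H}(j)\bigr|\le\epsilon .$$ (3) Whatever the samples in $\{0,\dots,n\}$ are, the sampler, given only the representation of the $\mathcal H$ that the learner outputs and independent uniformly random bits, outputs a draw from exactly $\mathcal{H}$, always using at most $C\log(n/\epsilon)$ random bits and at most $C(\log n+1/\epsilon)^c$ bit operations. -/

import Mathlib

open MeasureTheory ProbabilityTheory

/-! ### The target distribution: sums of independent Bernoulli variables -/

/-- The product distribution on `{0,1}^n` whose `i`-th bit is `1` with probability `p i`. -/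
noncomputable def productBits {n : ℕ} (p : Fin n → unitInterval) : Measure (Fin n → Bool) :=
  Measure.pi fun i => bernoulliMeasure true false (p i)

/-- The transformation `f x = x_1 + ... + x_n` on bit vectors. -/
def bitSum {n : ℕ} (x : Fin n → Bool) : ℕ := ∑ i, (x i).toNat

/-- The target distribution: the law of `bitSum X` for `X` distributed as `productBits p`. -/
noncomputable def sumOfBernoullis {n : ℕ} (p : Fin n → unitInterval) : Measure ℕ :=
  (productBits p).map bitSum

instance {n : ℕ} (p : Fin n → unitInterval) : IsProbabilityMeasure (productBits p) := by
  unfold productBits; infer_instance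

instance {n : ℕ} (p : Fin n → unitInterval) : IsProbabilityMeasure (sumOfBernoullis p) :=
  Measure.isProbabilityMeasure_map (measurable_of_countable bitSum).aemeasurable

/-- The law of an infinite sequence of independent samples from the target distribution. -/
noncomputable def sampleLaw {n : ℕ} (p : Fin n → unitInterval) : Measure (ℕ → ℕ) :=
  Measure.infinitePi fun _ : ℕ => sumOfBernoullis p

/-- The law of an infinite sequence of independent uniformly random bits. -/
noncomputable def coinLaw : Measure (ℕ → Bool) :=
  Measure.infinitePi fun _ : ℕ => (PMF.uniformOfFintype Bool).toMeasure

/-! ### Algorithms: a random access machine with bit costs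

A program works with finitely many registers and with an unbounded random access memory; both hold
natural numbers of arbitrary size.  It can draw the next item of an external stream (samples for
the learner, random bits for the sampler), and it can append a number to its output.  Every
elementary instruction is charged for the bits that it handles; multiplication and division are
charged for the schoolbook methods. -/

/-- Elementary instructions.  The arguments `x y z` are names of registers. -/
inductive Op : Type
  /-- `x := c` -/
  | const (x c : ℕ)
  /-- `x := y` -/
  | copy (x y : ℕ)
  /-- `x := y + z` -/
  | add (x y z : ℕ)
  /-- `x := max (y - z) 0` -/
  | sub (x y z : ℕ)
  /-- `x := y * z` -/
  | mul (x y z : ℕ)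
  /-- `x := ⌊y / z⌋`, and `x := 0` if `z = 0` -/
  | div (x y z : ℕ)
  /-- `x := mem[y]` -/
  | load (x y : ℕ)
  /-- `mem[x] := y` -/
  | store (x y : ℕ)
  /-- `x :=` the next item of the stream -/
  | draw (x : ℕ)
  /-- append `x` to the output -/
  | emit (x : ℕ)

/-- Programs: the usual control structures over the elementary instructions. -/
inductive Prog : Type
  | skip
  | op (o : Op)
  | seq (a b : Prog)
  /-- if register `x` is non-zero then `a` else `b` -/
  | cond (x : ℕ) (a b : Prog)
  /-- while register `x` is non-zero do `a` -/
  | loop (x : ℕ) (a : Prog)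

/-- Machine states.  `drawn` counts the stream items drawn so far, and `bitOps` the bit operations
performed so far. -/
structure MState : Type where
  reg : ℕ → ℕ
  mem : ℕ → ℕ
  out : List ℕ
  drawn : ℕ
  bitOps : ℕ

namespace MState

/-- The initial state: all registers are `0`, and the input occupies the beginning of an otherwise
zero memory. -/
def init (input : List ℕ) : MState where
  reg := fun _ => 0
  mem := fun i => input.getD i 0
  out := []
  drawn := 0
  bitOps := 0

/-- Charge `t` bit operations. -/
def charge (s : MState) (t : ℕ) : MState := { s with bitOps := s.bitOps + t }

/-- Assign `v` to register `x`. -/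
def set (s : MState) (x v : ℕ) : MState := { s with reg := Function.update s.reg x v }

end MState

/-- The effect and the cost of an elementary instruction, where `ω` is the external stream. -/
def Op.exec (ω : ℕ → ℕ) (s : MState) : Op → MState
  | .const x c => (s.set x c).charge (1 + c.size)
  | .copy x y => (s.set x (s.reg y)).charge (1 + (s.reg y).size)
  | .add x y z => (s.set x (s.reg y + s.reg z)).charge (1 + (s.reg y).size + (s.reg z).size)
  | .sub x y z => (s.set x (s.reg y - s.reg z)).charge (1 + (s.reg y).size + (s.reg z).size)
  | .mul x y z =>
      (s.set x (s.reg y * s.reg z)).charge ((1 + (s.reg y).size) * (1 + (s.reg z).size))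
  | .div x y z =>
      (s.set x (s.reg y / s.reg z)).charge ((1 + (s.reg y).size) * (1 + (s.reg z).size))
  | .load x y =>
      (s.set x (s.mem (s.reg y))).charge (1 + (s.reg y).size + (s.mem (s.reg y)).size)
  | .store x y =>
      { s with mem := Function.update s.mem (s.reg x) (s.reg y) }.charge
        (1 + (s.reg x).size + (s.reg y).size)
  | .draw x =>
      { s.set x (ω s.drawn) with drawn := s.drawn + 1 }.charge (1 + (ω s.drawn).size)
  | .emit x => { s with out := s.out ++ [s.reg x] }.charge (1 + (s.reg x).size)

/-- `Exec ω P s t`: the program `P`, started in state `s` with stream `ω`, halts in state `t`. -/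
inductive Exec (ω : ℕ → ℕ) : Prog → MState → MState → Prop
  | skip (s : MState) : Exec ω .skip s s
  | op (o : Op) (s : MState) : Exec ω (.op o) s (o.exec ω s)
  | seq {a b : Prog} {s t u : MState} (ha : Exec ω a s t) (hb : Exec ω b t u) :
      Exec ω (.seq a b) s u
  | cond_true {x : ℕ} {a b : Prog} {s t : MState} (hx : s.reg x ≠ 0)
      (ha : Exec ω a (s.charge (1 + (s.reg x).size)) t) : Exec ω (.cond x a b) s t
  | cond_false {x : ℕ} {a b : Prog} {s t : MState} (hx : s.reg x = 0)
      (hb : Exec ω b (s.charge 1) t) : Exec ω (.cond x a b) s t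
  | loop_done {x : ℕ} {a : Prog} {s : MState} (hx : s.reg x = 0) :
      Exec ω (.loop x a) s (s.charge 1)
  | loop_step {x : ℕ} {a : Prog} {s t u : MState} (hx : s.reg x ≠ 0)
      (ha : Exec ω a (s.charge (1 + (s.reg x).size)) t) (hl : Exec ω (.loop x a) t u) :
      Exec ω (.loop x a) s u

/-- `Prog.Runs P input ω t`: on the given input and stream, `P` halts in state `t`. -/
def Prog.Runs (P : Prog) (input : List ℕ) (ω : ℕ → ℕ) (t : MState) : Prop :=
  Exec ω P (MState.init input) t

/-! ### Histogram hypotheses -/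

/-- A succinctly represented histogram on an initial segment of `ℕ`.  An item `(l, w)` of `bins`
is an interval of `l` consecutive points with weight `w`; the intervals follow one another,
starting at the point `0`. -/
structure Histogram : Type where
  bins : List (ℕ × ℕ)

namespace Histogram

/-- The sum of all weights. -/
def totalWeight (H : Histogram) : ℕ := (H.bins.map Prod.snd).sum

/-- The histogram is one over `{0, ..., n}`: its intervals are non-empty and partition
`{0, ..., n}`, and its weights are not all zero. -/
def IsOver (H : Histogram) (n : ℕ) : Prop :=
  (∀ b ∈ H.bins, 0 < b.1) ∧ (H.bins.map Prod.fst).sum = n + 1 ∧ 0 < H.totalWeight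

/-- The weight of the point `j` in a list of intervals: the weight of the interval that contains
`j`, divided by the length of that interval. -/
noncomputable def pointWeight : List (ℕ × ℕ) → ℕ → ℝ
  | [], _ => 0
  | (l, w) :: bs, j => if j < l then (w : ℝ) / l else pointWeight bs (j - l)

/-- The hypothesis distribution: each interval has the probability `weight / totalWeight`, and the
distribution is uniform within each interval. -/
noncomputable def prob (H : Histogram) (j : ℕ) : ℝ := pointWeight H.bins j / H.totalWeight

/-- The representation handled by programs: the number of intervals, followed by the length and the
weight of each interval. -/
def encode (H : Histogram) : List ℕ :=
  H.bins.length :: H.bins.flatMap fun b => [b.1, b.2]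

/-- The program `S`, given the representation of `H` and independent uniformly random bits,
produces a draw from the distribution `H` on `{0, ..., n}`; whatever the random bits are, it uses at
most `r` of them and performs at most `t` bit operations. -/
def SampledBy (H : Histogram) (n : ℕ) (S : Prog) (r t : ℝ) : Prop :=
  (∀ b : ℕ → Bool, ∃ s : MState, S.Runs H.encode (fun i => (b i).toNat) s ∧
      (∃ j ≤ n, s.out = [j]) ∧ (s.drawn : ℝ) ≤ r ∧ (s.bitOps : ℝ) ≤ t) ∧
  ∀ j ≤ n, coinLaw.real {b : ℕ → Bool | ∃ s : MState,
      S.Runs H.encode (fun i => (b i).toNat) s ∧ s.out = [j]} = H.prob j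

/-- The total variation distance between a distribution `μ` on `{0, ..., n}` and `H`. -/
noncomputable def tvDist (n : ℕ) (μ : Measure ℕ) (H : Histogram) : ℝ :=
  (1 / 2) * ∑ j ∈ Finset.range (n + 1), |μ.real {j} - H.prob j|

end Histogram

/-!
The distribution of a sum of independent Bernoulli variables is log-concave, because a product of
polynomials with non-negative log-concave coefficients has log-concave coefficients. The learner
only uses this property.

It cuts `{0, ..., n}` at the points of a first batch of samples, whose size depends on the accuracy
`1 / E` only. By Chebyshev's inequality and monotonicity, the empirical distribution function is
uniformly close to the true one with high probability, so that each resulting interval, apart from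
the sampled points themselves, has a small mass `δ`. On an interval of mass `δ` with mass at least
`τ` on both sides, a log-concave function varies by a factor of at most `1 + δ / τ`, and is
therefore close to its average there; the remaining intervals have a small total mass. A second,
larger batch of samples determines the weights of the intervals.

The weights are rounded so that each one is a multiple of the length of its interval and that their
sum is a power of two. The sampler then needs only one uniformly random integer below the total
weight: it locates the interval by subtracting weights, and the point by a division.
-/

/-! ### A program logic for the machine -/

theorem Exec.deterministic {ω : ℕ → ℕ} {P : Prog} {s t t' : MState} (h : Exec ω P s t)
    (h' : Exec ω P s t') : t = t' := by
  induction h generalizing t' with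
  | skip s => cases h'; rfl
  | op o s => cases h'; rfl
  | seq _ _ iha ihb =>
    cases h' with
    | seq ha' hb' =>
      obtain rfl := iha ha'
      exact ihb hb'
  | cond_true hx _ ih =>
    cases h' with
    | cond_true _ h => exact ih h
    | cond_false h _ => exact absurd h hx
  | cond_false hx _ ih =>
    cases h' with
    | cond_true h _ => exact absurd hx h
    | cond_false _ h => exact ih h
  | loop_done hx =>
    cases h' with
    | loop_done _ => rfl
    | loop_step h _ _ => exact absurd hx h
  | loop_step hx _ _ iha ihl =>
    cases h' with
    | loop_done h => exact absurd h hx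
    | loop_step _ ha' hl' =>
      obtain rfl := iha ha'
      exact ihl hl'

/-- A machine state without the count of bit operations: what a program computes depends on the
configuration only. -/
structure Config : Type where
  reg : ℕ → ℕ
  mem : ℕ → ℕ
  out : List ℕ
  drawn : ℕ

namespace Config

/-- The machine state with configuration `σ` after `t` bit operations. -/
def withOps (σ : Config) (t : ℕ) : MState := ⟨σ.reg, σ.mem, σ.out, σ.drawn, t⟩

/-- The configuration that differs from `σ` in that register `x` holds `v`. -/
def set (σ : Config) (x v : ℕ) : Config := { σ with reg := Function.update σ.reg x v }

/-- The configuration in which a program is started on the given input. -/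
def init (input : List ℕ) : Config := ⟨fun _ => 0, fun i => input.getD i 0, [], 0⟩

@[simp] theorem set_mem (σ : Config) (x v : ℕ) : (σ.set x v).mem = σ.mem := rfl
@[simp] theorem set_out (σ : Config) (x v : ℕ) : (σ.set x v).out = σ.out := rfl
@[simp] theorem set_drawn (σ : Config) (x v : ℕ) : (σ.set x v).drawn = σ.drawn := rfl

@[simp] theorem set_reg (σ : Config) (x v y : ℕ) :
    (σ.set x v).reg y = if y = x then v else σ.reg y :=
  Function.update_apply _ _ _ _

end Config

/-- The effect of an elementary instruction on configurations. -/
@[simp] def Op.step (ω : ℕ → ℕ) (σ : Config) : Op → Config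
  | .const x c => σ.set x c
  | .copy x y => σ.set x (σ.reg y)
  | .add x y z => σ.set x (σ.reg y + σ.reg z)
  | .sub x y z => σ.set x (σ.reg y - σ.reg z)
  | .mul x y z => σ.set x (σ.reg y * σ.reg z)
  | .div x y z => σ.set x (σ.reg y / σ.reg z)
  | .load x y => σ.set x (σ.mem (σ.reg y))
  | .store x y => { σ with mem := Function.update σ.mem (σ.reg x) (σ.reg y) }
  | .draw x => { σ.set x (ω σ.drawn) with drawn := σ.drawn + 1 }
  | .emit x => { σ with out := σ.out ++ [σ.reg x] }

/-- All numbers that an instruction handles are at most `B`. -/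
@[simp] def Op.Bounded (ω : ℕ → ℕ) (B : ℕ) (σ : Config) : Op → Prop
  | .const _ c => c ≤ B
  | .copy _ y => σ.reg y ≤ B
  | .add _ y z => σ.reg y ≤ B ∧ σ.reg z ≤ B
  | .sub _ y z => σ.reg y ≤ B ∧ σ.reg z ≤ B
  | .mul _ y z => σ.reg y ≤ B ∧ σ.reg z ≤ B
  | .div _ y z => σ.reg y ≤ B ∧ σ.reg z ≤ B
  | .load _ y => σ.reg y ≤ B ∧ σ.mem (σ.reg y) ≤ B
  | .store x y => σ.reg x ≤ B ∧ σ.reg y ≤ B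
  | .draw _ => ω σ.drawn ≤ B
  | .emit x => σ.reg x ≤ B

/-- The cost of an instruction in units of `1 + 2 * B.size` bit operations, when all numbers are at
most `B`. -/
def Op.units (B : ℕ) : Op → ℕ
  | .mul _ _ _ => 1 + B.size
  | .div _ _ _ => 1 + B.size
  | _ => 1

theorem Op.exec_withOps {ω : ℕ → ℕ} {B : ℕ} {σ : Config} {o : Op} (h : o.Bounded ω B σ) (t : ℕ) :
    ∃ t' ≤ t + o.units B * (1 + 2 * B.size), o.exec ω (σ.withOps t) = (o.step ω σ).withOps t' := by
  have schoolbook {a b : ℕ} (ha : a ≤ B) (hb : b ≤ B) :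
      (1 + a.size) * (1 + b.size) ≤ (1 + B.size) * (1 + 2 * B.size) := by
    have := Nat.size_le_size ha
    have := Nat.size_le_size hb
    gcongr; omega
  cases o <;> simp only [Op.Bounded] at h <;> refine ⟨_, ?_, rfl⟩
  case mul | div => exact Nat.add_le_add_left (schoolbook h.1 h.2) t
  case const | copy | draw | emit =>
    have := Nat.size_le_size h
    simp only [Op.units, Config.withOps, MState.set]
    omega
  case add | sub | load | store =>
    have := Nat.size_le_size h.1
    have := Nat.size_le_size h.2
    simp only [Op.units, Config.withOps, MState.set]
    omega

/-! ### What a program leaves unchanged -/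

namespace Op

/-- Does the instruction assign to register `r`? -/
def writes (r : ℕ) : Op → Bool
  | .const x _ | .copy x _ | .add x _ _ | .sub x _ _ | .mul x _ _ | .div x _ _ | .load x _
  | .draw x => x == r
  | .store _ _ | .emit _ => false

/-- Does the instruction write to the memory? -/
def isStore : Op → Bool
  | .store _ _ => true
  | _ => false

/-- Does the instruction write to the output? -/
def isEmit : Op → Bool
  | .emit _ => true
  | _ => false

/-- Does the instruction read from the stream? -/
def isDraw : Op → Bool
  | .draw _ => true
  | _ => false

end Op

namespace Prog

/-- Does some elementary instruction of the program have the property `f`? -/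
def any (f : Op → Bool) : Prog → Bool
  | .skip => false
  | .op o => f o
  | .seq a b | .cond _ a b => a.any f || b.any f
  | .loop _ a => a.any f

/-- The configurations `σ` and `τ` agree on every part of the machine on which no instruction of
`P` has an effect. -/
structure Frame (P : Prog) (σ τ : Config) : Prop where
  reg : ∀ {r : ℕ}, P.any (Op.writes r) = false → τ.reg r = σ.reg r
  mem : P.any Op.isStore = false → τ.mem = σ.mem
  out : P.any Op.isEmit = false → τ.out = σ.out
  drawn : P.any Op.isDraw = false → τ.drawn = σ.drawn

end Prog

theorem Exec.apply_eq {α : Type*} {ω : ℕ → ℕ} {g : MState → α} {f : Op → Bool}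
    (hcharge : ∀ s t, g (s.charge t) = g s) (hop : ∀ o s, f o = false → g (o.exec ω s) = g s)
    {P : Prog} {s t : MState} (h : Exec ω P s t) (hP : P.any f = false) : g t = g s := by
  induction h with
  | skip s => rfl
  | op o s => exact hop o s hP
  | seq _ _ iha ihb =>
    rw [Prog.any, Bool.or_eq_false_iff] at hP
    rw [ihb hP.2, iha hP.1]
  | cond_true _ _ ih =>
    rw [Prog.any, Bool.or_eq_false_iff] at hP
    rw [ih hP.1, hcharge]
  | cond_false _ _ ih =>
    rw [Prog.any, Bool.or_eq_false_iff] at hP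
    rw [ih hP.2, hcharge]
  | loop_done _ => exact hcharge _ _
  | loop_step _ _ _ iha ihl => rw [ihl hP, iha hP, hcharge]

theorem Exec.frame {ω : ℕ → ℕ} {P : Prog} {σ τ : Config} {t t' : ℕ}
    (h : Exec ω P (σ.withOps t) (τ.withOps t')) : P.Frame σ τ where
  reg {r} := h.apply_eq (g := fun s => s.reg r) (fun _ _ => rfl) fun o s ho => by
    cases o <;> first | rfl | exact Function.update_of_ne (beq_eq_false_iff_ne.1 ho).symm _ _
  mem := h.apply_eq (g := MState.mem) (fun _ _ => rfl) fun o s ho => by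
    cases o <;> first | rfl | cases ho
  out := h.apply_eq (g := MState.out) (fun _ _ => rfl) fun o s ho => by
    cases o <;> first | rfl | cases ho
  drawn := h.apply_eq (g := MState.drawn) (fun _ _ => rfl) fun o s ho => by
    cases o <;> first | rfl | cases ho

/-! ### Total correctness with costs -/

/-- `Spec ω B P σ k Q`: started in `σ`, the program `P` halts in a configuration with property `Q`
at the cost of at most `k` units of `1 + 2 * B.size` bit operations. -/
def Spec (ω : ℕ → ℕ) (B : ℕ) (P : Prog) (σ : Config) (k : ℕ) (Q : Config → Prop) : Prop :=
  ∀ t, ∃ τ, Q τ ∧ ∃ t' ≤ t + k * (1 + 2 * B.size), Exec ω P (σ.withOps t) (τ.withOps t')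

/-- Sequential composition of a list of programs. -/
def Prog.block : List Prog → Prog
  | [] => .skip
  | p :: ps => .seq p (Prog.block ps)

/-- A straight-line program. -/
def Prog.straight (os : List Op) : Prog := .block (os.map .op)

/-- The condition under which the straight-line program `os`, started in `σ`, handles only numbers
up to `B` and ends in a configuration with property `Q`. -/
@[simp] def Op.Post (ω : ℕ → ℕ) (B : ℕ) (Q : Config → Prop) : List Op → Config → Prop
  | [], σ => Q σ
  | o :: os, σ => o.Bounded ω B σ ∧ Op.Post ω B Q os (o.step ω σ)

namespace Spec

variable {ω : ℕ → ℕ} {B : ℕ} {P : Prog} {ps : List Prog} {σ : Config} {k k' : ℕ}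
  {Q Q' : Config → Prop}

theorem mono (h : Spec ω B P σ k Q) (hk : k ≤ k') (hQ : ∀ τ, Q τ → P.Frame σ τ → Q' τ) :
    Spec ω B P σ k' Q' := by
  intro t
  obtain ⟨τ, hτ, t', ht', he⟩ := h t
  exact ⟨τ, hQ τ hτ he.frame, t', ht'.trans (by gcongr), he⟩

theorem weaken (h : Spec ω B P σ k Q) (hk : k ≤ k') : Spec ω B P σ k' Q :=
  h.mono hk fun _ hτ _ => hτ

theorem nil (h : Q σ) : Spec ω B (.block []) σ 0 Q :=
  fun t => ⟨σ, h, t, Nat.le_add_right _ _, .skip _⟩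

theorem cons (h : Spec ω B P σ k Q)
    (h' : ∀ τ, Q τ → P.Frame σ τ → Spec ω B (.block ps) τ k' Q') :
    Spec ω B (.block (P :: ps)) σ (k + k') Q' := by
  intro t
  obtain ⟨τ, hτ, t', ht', he⟩ := h t
  obtain ⟨υ, hυ, t'', ht'', he'⟩ := h' τ hτ he.frame t'
  refine ⟨υ, hυ, t'', ?_, .seq he he'⟩
  rw [add_mul]
  omega

theorem last (h : Spec ω B P σ k Q) : Spec ω B (.block [P]) σ k Q :=
  cons h fun _ hτ _ => nil hτ

theorem op {o : Op} (h : o.Bounded ω B σ) (hQ : Q (o.step ω σ)) :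
    Spec ω B (.op o) σ (o.units B) Q := by
  intro t
  obtain ⟨t', ht', he⟩ := o.exec_withOps h t
  exact ⟨_, hQ, t', ht', he ▸ .op o _⟩

theorem straight {os : List Op} (h : Op.Post ω B Q os σ) (hk : (os.map (Op.units B)).sum ≤ k) :
    Spec ω B (.straight os) σ k Q := by
  refine weaken ?_ hk
  clear hk
  induction os generalizing σ with
  | nil => exact nil h
  | cons o os ih => exact cons (op h.1 h.2) fun _ hτ _ => ih hτ

theorem cond {x : ℕ} {a b : Prog} (hx : σ.reg x ≤ B) (ha : σ.reg x ≠ 0 → Spec ω B a σ k Q)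
    (hb : σ.reg x = 0 → Spec ω B b σ k Q) : Spec ω B (.cond x a b) σ (1 + k) Q := by
  intro t
  have := Nat.size_le_size hx
  rcases eq_or_ne (σ.reg x) 0 with h0 | h0
  · obtain ⟨τ, hτ, t', ht', he⟩ := hb h0 (t + 1)
    refine ⟨τ, hτ, t', ?_, .cond_false h0 he⟩
    rw [add_mul]
    omega
  · obtain ⟨τ, hτ, t', ht', he⟩ := ha h0 (t + (1 + (σ.reg x).size))
    refine ⟨τ, hτ, t', ?_, .cond_true h0 he⟩
    rw [add_mul]
    omega

theorem loop_done {x : ℕ} {a : Prog} (hx : σ.reg x = 0) (hQ : Q σ) :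
    Spec ω B (.loop x a) σ 1 Q :=
  fun t => ⟨σ, hQ, t + 1, by omega, .loop_done hx⟩

theorem loop_step {x : ℕ} {a : Prog} (hx : σ.reg x ≠ 0) (hB : σ.reg x ≤ B)
    (ha : Spec ω B a σ k Q) (hl : ∀ τ, Q τ → a.Frame σ τ → Spec ω B (.loop x a) τ k' Q') :
    Spec ω B (.loop x a) σ (1 + k + k') Q' := by
  intro t
  have := Nat.size_le_size hB
  obtain ⟨τ, hτ, t', ht', he⟩ := ha (t + (1 + (σ.reg x).size))
  obtain ⟨υ, hυ, t'', ht'', he'⟩ := hl τ hτ he.frame t'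
  refine ⟨υ, hυ, t'', ?_, .loop_step hx he he'⟩
  rw [add_mul, add_mul]
  omega

theorem runs {input : List ℕ} (h : Spec ω B P (.init input) k Q) :
    ∃ s, P.Runs input ω s ∧ s.bitOps ≤ k * (1 + 2 * B.size) ∧
      Q ⟨s.reg, s.mem, s.out, s.drawn⟩ := by
  obtain ⟨τ, hτ, t', ht', he⟩ := h 0
  exact ⟨_, he, ht'.trans_eq (zero_add _), hτ⟩

end Spec

/-! ### Histograms in memory -/

namespace Histogram

/-- The list of bins is stored in memory from address `a` on. -/
def Stored (mem : ℕ → ℕ) : ℕ → List (ℕ × ℕ) → Prop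
  | _, [] => True
  | a, b :: bs => mem a = b.1 ∧ mem (a + 1) = b.2 ∧ Stored mem (a + 2) bs

theorem stored_of_getD {mem : ℕ → ℕ} {bs : List (ℕ × ℕ)} {a : ℕ}
    (h : ∀ i, mem (a + i) = (bs.flatMap fun b => [b.1, b.2]).getD i 0) : Stored mem a bs := by
  induction bs generalizing a with
  | nil => trivial
  | cons b bs ih => exact ⟨h 0, h 1, ih fun i => by rw [add_assoc, add_comm 2 i]; exact h (i + 2)⟩

theorem stored_encode (H : Histogram) : Stored (Config.init H.encode).mem 1 H.bins :=
  stored_of_getD fun i => by rw [add_comm]; rfl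

/-- The sum of the lengths of a list of bins. -/
def len (bs : List (ℕ × ℕ)) : ℕ := (bs.map Prod.fst).sum

/-- The sum of the weights of a list of bins. -/
def wt (bs : List (ℕ × ℕ)) : ℕ := (bs.map Prod.snd).sum

@[simp] theorem len_nil : len [] = 0 := rfl
@[simp] theorem wt_nil : wt [] = 0 := rfl
@[simp] theorem len_cons (b : ℕ × ℕ) (bs : List (ℕ × ℕ)) : len (b :: bs) = b.1 + len bs := rfl
@[simp] theorem wt_cons (b : ℕ × ℕ) (bs : List (ℕ × ℕ)) : wt (b :: bs) = b.2 + wt bs := rfl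

/-- The point selected by the number `u`, where the bin `(l, w)` receives `w` numbers, which it
assigns to its points cyclically. -/
def locate : List (ℕ × ℕ) → ℕ → ℕ
  | [], _ => 0
  | b :: bs, u => if u < b.2 then u % b.1 else b.1 + locate bs (u - b.2)

theorem locate_cons_of_lt {b : ℕ × ℕ} {u : ℕ} (h : u < b.2) (bs : List (ℕ × ℕ)) :
    locate (b :: bs) u = u % b.1 :=
  if_pos h

theorem locate_cons_of_le {b : ℕ × ℕ} {u : ℕ} (h : b.2 ≤ u) (bs : List (ℕ × ℕ)) :
    locate (b :: bs) u = b.1 + locate bs (u - b.2) :=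
  if_neg h.not_gt

theorem locate_lt_len {bs : List (ℕ × ℕ)} (hp : ∀ b ∈ bs, 0 < b.1) {u : ℕ} (hu : u < wt bs) :
    locate bs u < len bs := by
  induction bs generalizing u with
  | nil => exact absurd hu (Nat.not_lt_zero u)
  | cons b bs ih =>
    rw [List.forall_mem_cons] at hp
    rw [wt_cons] at hu
    rw [len_cons]
    rcases lt_or_ge u b.2 with h | h
    · rw [locate_cons_of_lt h]
      exact (Nat.mod_lt u hp.1).trans_le (Nat.le_add_right _ _)
    · rw [locate_cons_of_le h]
      exact Nat.add_lt_add_left (ih hp.2 (by omega)) _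

end Histogram

/-! ### The sampler -/

/-- The number whose binary digits are the first `t` items of `ω`. -/
def readBits (ω : ℕ → ℕ) : ℕ → ℕ
  | 0 => 0
  | t + 1 => 2 * readBits ω t + ω t

theorem readBits_lt {ω : ℕ → ℕ} (h : ∀ i, ω i ≤ 1) (t : ℕ) : readBits ω t < 2 ^ t := by
  induction t with
  | zero => exact one_pos
  | succ t ih =>
    have := h t
    rw [readBits, pow_succ]
    omega

namespace Sampler

open Histogram

/-- Add up the weights of the remaining bins, as many as register `4` says, in register `3`. -/
def sumWeights : Prog :=
  .loop 4 (.straight [.add 1 1 2, .add 1 1 2, .load 5 1, .add 3 3 5, .sub 4 4 2])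

/-- Compute the total weight in register `3`. -/
def loadTotalWeight : Prog := .block [.straight [.const 2 1, .load 0 5, .copy 4 0], sumWeights]

/-- Read bits into register `7`, and double register `8` each time, until it reaches the total
weight. -/
def drawBits : Prog :=
  .loop 13 (.straight [.draw 5, .add 7 7 7, .add 7 7 5, .add 8 8 8, .sub 13 3 8])

/-- Draw a number below the total weight, which must be a power of two, into register `7`. -/
def drawNumber : Prog := .block [.straight [.const 8 1, .sub 13 3 8], drawBits]

/-- Emit the point of the current interval selected by register `7` and end the search. -/
def select : Prog :=
  .straight [.div 5 7 11, .mul 5 5 11, .sub 7 7 5, .add 9 9 7, .emit 9, .const 10 0]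

/-- Load the next interval and treat it. -/
def visit : Prog :=
  .block [.straight [.load 11 1, .add 1 1 2, .load 12 1, .add 1 1 2, .sub 13 12 7],
    .cond 13 select (.straight [.sub 7 7 12, .add 9 9 11])]

/-- Search the bins for the point selected by register `7`. -/
def search : Prog := .loop 10 visit

/-- Emit the point selected by register `7`. -/
def emitPoint : Prog := .block [.straight [.const 1 1, .const 10 1], search]

variable {ω : ℕ → ℕ} {B : ℕ} {σ : Config}

theorem sumWeights_spec {bs : List (ℕ × ℕ)} (hst : Stored σ.mem (σ.reg 1 + 1) bs)
    (h4 : σ.reg 4 = bs.length) (h2 : σ.reg 2 = 1) (ha : σ.reg 1 + 2 * bs.length + 1 ≤ B)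
    (hw : σ.reg 3 + wt bs ≤ B) :
    Spec ω B sumWeights σ (6 * bs.length + 1) fun τ => τ.reg 3 = σ.reg 3 + wt bs := by
  induction bs generalizing σ with
  | nil => exact .loop_done h4 rfl
  | cons b bs ih =>
    obtain ⟨-, h, hst⟩ := hst
    rw [wt_cons] at hw ⊢
    rw [List.length_cons] at h4 ha
    have body : Op.Post ω B (fun τ => τ.reg 1 = σ.reg 1 + 2 ∧ τ.reg 3 = σ.reg 3 + b.2 ∧
        τ.reg 4 = bs.length) [.add 1 1 2, .add 1 1 2, .load 5 1, .add 3 3 5, .sub 4 4 2] σ := by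
      simp [h2, h, add_assoc]
      omega
    refine Spec.weaken (.loop_step (k' := 6 * bs.length + 1) (by omega) (by omega)
      (.straight (k := 5) body le_rfl) fun τ ⟨t1, _, t4⟩ hf => ?_)
      (by rw [List.length_cons]; omega)
    have hmem := hf.mem rfl
    have hone := hf.reg (r := 2) rfl
    exact (ih (by rwa [hmem, t1, add_right_comm]) t4 (by omega) (by omega) (by omega)).mono le_rfl
      fun υ hυ _ => by omega

theorem drawBits_spec {t j i : ℕ} (hω : ∀ i, ω i ≤ 1) (hj : j + i = t) (h3 : σ.reg 3 = 2 ^ t)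
    (h7 : σ.reg 7 = readBits ω j) (h8 : σ.reg 8 = 2 ^ j) (h13 : σ.reg 13 = 2 ^ t - 2 ^ j)
    (hd : σ.drawn = j) (hB : 2 ^ t ≤ B) :
    Spec ω B drawBits σ (6 * i + 1) fun τ => τ.reg 7 = readBits ω t ∧ τ.drawn = t := by
  induction i generalizing σ j with
  | zero =>
    obtain rfl : j = t := hj
    exact .loop_done (by rw [h13, Nat.sub_self]) ⟨h7, hd⟩
  | succ i ih =>
    have hle : 2 ^ (j + 1) ≤ 2 ^ t := Nat.pow_le_pow_right two_pos (by omega)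
    have hlt := readBits_lt hω j
    have hbit := hω j
    have : 2 ^ (j + 1) = 2 ^ j + 2 ^ j := by ring
    have body : Op.Post ω B (fun τ => τ.reg 7 = readBits ω (j + 1) ∧ τ.reg 8 = 2 ^ (j + 1) ∧
        τ.reg 13 = 2 ^ t - 2 ^ (j + 1) ∧ τ.drawn = j + 1)
        [.draw 5, .add 7 7 7, .add 7 7 5, .add 8 8 8, .sub 13 3 8] σ := by
      simp [readBits, hd]
      omega
    refine Spec.weaken (.loop_step (k' := 6 * i + 1) (by omega) (by omega)
      (.straight (k := 5) body le_rfl) fun τ ⟨t7, t8, t13, td⟩ hf => ?_) (by omega)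
    exact ih (by omega) (by rw [hf.reg rfl, h3]) t7 t8 t13 td

theorem select_spec {l : ℕ} (h7 : σ.reg 7 ≤ B) (h11 : σ.reg 11 = l) (hl : 0 < l)
    (h9 : σ.reg 9 + l ≤ B) :
    Spec ω B select σ (6 + 2 * B.size) fun τ =>
      τ.out = σ.out ++ [σ.reg 9 + σ.reg 7 % l] ∧ τ.reg 10 = 0 := by
  have hmod := Nat.mod_lt (σ.reg 7) hl
  have hdiv : σ.reg 7 / l ≤ σ.reg 7 := Nat.div_le_self _ _
  have hsub : σ.reg 7 - σ.reg 7 / l * l = σ.reg 7 % l := by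
    rw [mul_comm, Nat.mod_def]
  have hmul : σ.reg 7 / l * l ≤ σ.reg 7 := Nat.div_mul_le_self _ _
  refine .straight ?_ (by simp [Op.units]; omega)
  simp [hsub, h11]
  omega

theorem visit_spec {l w : ℕ} (h2 : σ.reg 2 = 1) (hlen : σ.mem (σ.reg 1) = l)
    (hwt : σ.mem (σ.reg 1 + 1) = w) (ha : σ.reg 1 + 2 ≤ B) (h7 : σ.reg 7 ≤ B) (hl : 0 < l)
    (h9 : σ.reg 9 + l ≤ B) (hw : w ≤ B) :
    Spec ω B visit σ (12 + 2 * B.size) fun τ =>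
      (σ.reg 7 < w → τ.reg 10 = 0 ∧ τ.out = σ.out ++ [σ.reg 9 + σ.reg 7 % l]) ∧
      (w ≤ σ.reg 7 → τ.reg 10 = σ.reg 10 ∧ τ.reg 1 = σ.reg 1 + 2 ∧ τ.reg 7 = σ.reg 7 - w ∧
        τ.reg 9 = σ.reg 9 + l ∧ τ.out = σ.out) := by
  have fetch : Op.Post ω B (fun τ => τ.reg 1 = σ.reg 1 + 2 ∧ τ.reg 11 = l ∧ τ.reg 12 = w ∧
      τ.reg 13 = w - σ.reg 7) [.load 11 1, .add 1 1 2, .load 12 1, .add 1 1 2, .sub 13 12 7] σ := by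
    simp [hlen, h2, hwt]
    omega
  refine Spec.weaken (.cons (.straight (k := 5) fetch le_rfl) fun τ ⟨t1, t11, t12, _⟩ hf =>
    .last (.cond (k := 6 + 2 * B.size) (by omega) (fun h => ?_) fun h => ?_)) (by omega)
  · have hout := hf.out rfl
    have h7' := hf.reg (r := 7) rfl
    have h9' := hf.reg (r := 9) rfl
    refine (select_spec (by omega) t11 hl (by omega)).mono le_rfl fun υ ⟨hυ, h10⟩ _ =>
      ⟨fun _ => ⟨h10, by rw [hυ, hout, h7', h9']⟩, fun hle => by omega⟩
  · have h7' := hf.reg (r := 7) rfl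
    have h9' := hf.reg (r := 9) rfl
    have advance : Op.Post ω B (fun υ => υ.reg 7 = σ.reg 7 - w ∧ υ.reg 9 = σ.reg 9 + l)
        [.sub 7 7 12, .add 9 9 11] τ := by
      simp [h7', h9', t11, t12]
      omega
    refine (Spec.straight (k := 2) advance le_rfl).mono (by omega) fun υ ⟨u7, u9⟩ hf' =>
      ⟨fun hlt => by omega, fun _ => ⟨?_, ?_, u7, u9, ?_⟩⟩
    · rw [hf'.reg rfl, hf.reg rfl]
    · rw [hf'.reg rfl, t1]
    · rw [hf'.out rfl, hf.out rfl]

theorem search_spec {bs : List (ℕ × ℕ)} (hst : Stored σ.mem (σ.reg 1) bs) (h2 : σ.reg 2 = 1)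
    (ha : σ.reg 1 + 2 * bs.length ≤ B) (h10 : σ.reg 10 = 1) (hu : σ.reg 7 < wt bs)
    (hw : wt bs ≤ B) (hl : σ.reg 9 + len bs ≤ B) (hp : ∀ b ∈ bs, 0 < b.1) :
    Spec ω B search σ (bs.length * (13 + 2 * B.size) + 1) fun τ =>
      τ.out = σ.out ++ [σ.reg 9 + locate bs (σ.reg 7)] := by
  induction bs generalizing σ with
  | nil => exact absurd hu (Nat.not_lt_zero _)
  | cons b bs ih =>
    obtain ⟨hlen, hwt, hst⟩ := hst
    rw [wt_cons] at hw hu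
    rw [List.length_cons] at ha
    rw [len_cons] at hl
    rw [List.forall_mem_cons] at hp
    refine Spec.weaken (.loop_step (k' := bs.length * (13 + 2 * B.size) + 1) (by omega) (by omega)
      (visit_spec h2 hlen hwt (by omega) (by omega) hp.1 (by omega) (by omega))
      fun τ ⟨hit, miss⟩ hf => ?_) (by rw [List.length_cons, add_mul]; omega)
    rcases lt_or_ge (σ.reg 7) b.2 with hlt | hle
    · obtain ⟨t10, hout⟩ := hit hlt
      exact (Spec.loop_done t10 (by rw [hout, locate_cons_of_lt hlt])).weaken (by omega)
    · obtain ⟨t10, t1, t7, t9, hout⟩ := miss hle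
      refine (ih (by rwa [hf.mem rfl, t1]) (by rw [hf.reg rfl, h2]) (by omega) (by omega) (by omega)
        (by omega) (by omega) hp.2).mono le_rfl fun υ hυ _ => ?_
      rw [hυ, hout, t9, t7, locate_cons_of_le hle, add_assoc]

/-- The sampler: one uniformly random number below the total weight selects both the interval and
the point in it. -/
def prog : Prog :=
  .block [loadTotalWeight, drawNumber, emitPoint]

theorem loadTotalWeight_spec {H : Histogram} (hN : 2 * H.bins.length + 1 ≤ B) (hw : wt H.bins ≤ B) :
    Spec ω B loadTotalWeight (.init H.encode) (6 * H.bins.length + 4) fun τ =>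
      τ.reg 2 = 1 ∧ τ.reg 3 = wt H.bins := by
  have hcount : (Config.init H.encode).mem 0 = H.bins.length := rfl
  have hreg (r : ℕ) : (Config.init H.encode).reg r = 0 := rfl
  have header : Op.Post ω B (fun τ => τ.reg 1 = 0 ∧ τ.reg 2 = 1 ∧ τ.reg 3 = 0 ∧
      τ.reg 4 = H.bins.length) [.const 2 1, .load 0 5, .copy 4 0] (.init H.encode) := by
    simp [hreg, hcount]
    omega
  refine Spec.weaken (.cons (.straight (k := 3) header le_rfl) fun σ₁ ⟨h1, h2, h3, h4⟩ f₁ =>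
    .last (k := 6 * H.bins.length + 1) ?_) (by omega)
  refine (sumWeights_spec (bs := H.bins) ?_ h4 h2 (by omega) (by omega)).mono le_rfl
    fun τ hτ f₂ => ⟨(f₂.reg rfl).trans h2, by rw [hτ, h3, zero_add]⟩
  rw [f₁.mem rfl, h1]
  exact stored_encode H

theorem drawNumber_spec {t : ℕ} (hω : ∀ i, ω i ≤ 1) (h3 : σ.reg 3 = 2 ^ t) (h7 : σ.reg 7 = 0)
    (hd : σ.drawn = 0) (hB : 2 ^ t ≤ B) :
    Spec ω B drawNumber σ (6 * t + 3) fun τ => τ.reg 7 = readBits ω t ∧ τ.drawn = t := by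
  have hpos : 0 < 2 ^ t := Nat.two_pow_pos t
  have start : Op.Post ω B (fun τ => τ.reg 8 = 2 ^ 0 ∧ τ.reg 13 = 2 ^ t - 2 ^ 0)
      [.const 8 1, .sub 13 3 8] σ := by
    simp [h3]
    omega
  refine Spec.weaken (.cons (.straight (k := 2) start le_rfl) fun σ₁ ⟨h8, h13⟩ f₁ =>
    .last (drawBits_spec (j := 0) hω (zero_add t) ?_ ?_ h8 h13 ?_ hB)) (by omega)
  · exact (f₁.reg rfl).trans h3
  · exact (f₁.reg rfl).trans h7
  · exact (f₁.drawn rfl).trans hd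

theorem emitPoint_spec {bs : List (ℕ × ℕ)} (hst : Stored σ.mem 1 bs) (h2 : σ.reg 2 = 1)
    (h9 : σ.reg 9 = 0) (hout : σ.out = []) (hN : 2 * bs.length + 1 ≤ B) (hu : σ.reg 7 < wt bs)
    (hw : wt bs ≤ B) (hl : len bs ≤ B) (hp : ∀ b ∈ bs, 0 < b.1) :
    Spec ω B emitPoint σ (bs.length * (13 + 2 * B.size) + 3) fun τ =>
      τ.out = [locate bs (σ.reg 7)] := by
  have start : Op.Post ω B (fun τ => τ.reg 1 = 1 ∧ τ.reg 10 = 1) [.const 1 1, .const 10 1] σ := by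
    simp
    omega
  refine Spec.weaken (.cons (.straight (k := 2) start le_rfl) fun τ ⟨t1, t10⟩ hf => .last
    (k := bs.length * (13 + 2 * B.size) + 1) ?_) (by omega)
  have t7 : τ.reg 7 = σ.reg 7 := hf.reg rfl
  have t9 : τ.reg 9 = 0 := (hf.reg rfl).trans h9
  refine (search_spec (bs := bs) ?_ ((hf.reg rfl).trans h2) (by omega) t10 (by omega) hw (by omega)
    hp).mono le_rfl fun υ hυ _ => ?_
  · rwa [hf.mem rfl, t1]
  · rw [hυ, hf.out rfl, hout, t9, t7, zero_add, List.nil_append]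

theorem prog_spec {H : Histogram} {t : ℕ} (hω : ∀ i, ω i ≤ 1) (hp : ∀ b ∈ H.bins, 0 < b.1)
    (hw : wt H.bins = 2 ^ t) (hN : 2 * H.bins.length + 1 ≤ B) (hwB : 2 ^ t ≤ B)
    (hl : len H.bins ≤ B) :
    Spec ω B prog (.init H.encode) ((H.bins.length + t + 1) * (23 + 2 * B.size)) fun τ =>
      τ.out = [locate H.bins (readBits ω t)] ∧ τ.drawn = t := by
  refine Spec.weaken (.cons (loadTotalWeight_spec hN (hw.trans_le hwB)) fun σ₁ ⟨h2, h3⟩ f₁ =>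
    .cons (drawNumber_spec hω (h3.trans hw) (f₁.reg rfl) (f₁.drawn rfl) hwB)
      fun σ₂ ⟨h7, hd⟩ f₂ => .last (k := H.bins.length * (13 + 2 * B.size) + 3) ?_) ?_
  · have hmem : σ₂.mem = (Config.init H.encode).mem := (f₂.mem rfl).trans (f₁.mem rfl)
    refine (emitPoint_spec (bs := H.bins) (hmem ▸ stored_encode H) ((f₂.reg rfl).trans h2)
      ((f₂.reg rfl).trans (f₁.reg rfl)) ((f₂.out rfl).trans (f₁.out rfl)) hN ?_ (hw.trans_le hwB)
      hl hp).mono le_rfl fun τ hτ f₃ => ⟨h7 ▸ hτ, (f₃.drawn rfl).trans hd⟩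
    rw [h7, hw]
    exact readBits_lt hω t
  · ring_nf
    have := Nat.zero_le (t * B.size)
    omega

end Sampler

theorem count_mod_eq {l j : ℕ} (hj : j < l) (q : ℕ) : Nat.count (· % l = j) (l * q) = q := by
  have h := Nat.count_modEq_card (b := l * q) (Nat.zero_lt_of_lt hj) j
  rw [Nat.mul_mod_right, if_neg (Nat.not_lt_zero _), add_zero,
    Nat.mul_div_cancel_left _ (Nat.zero_lt_of_lt hj)] at h
  simpa only [Nat.ModEq, Nat.mod_eq_of_lt hj] using h

theorem Histogram.count_locate {bs : List (ℕ × ℕ)} (hp : ∀ b ∈ bs, 0 < b.1)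
    (hd : ∀ b ∈ bs, b.1 ∣ b.2) (j : ℕ) :
    (Nat.count (locate bs · = j) (wt bs) : ℝ) = pointWeight bs j := by
  induction bs generalizing j with
  | nil => simp [pointWeight]
  | cons b bs ih =>
    obtain ⟨l, w⟩ := b
    rw [List.forall_mem_cons] at hp hd
    obtain ⟨⟨q, hq⟩, hd⟩ := hd
    obtain rfl : w = l * q := hq
    have hl : (l : ℝ) ≠ 0 := Nat.cast_ne_zero.2 hp.1.ne'
    have inside : Nat.count (locate ((l, l * q) :: bs) · = j) (l * q) = if j < l then q else 0 := by
      rw [Nat.count_eq_card_filter_range, Finset.filter_congr (q := (· % l = j)) fun u hu => by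
        rw [locate_cons_of_lt (Finset.mem_range.1 hu)], ← Nat.count_eq_card_filter_range]
      split_ifs with h
      · exact count_mod_eq h q
      · exact Nat.count_of_forall_not fun u _ hu => h (hu ▸ Nat.mod_lt u hp.1)
    have outside : (fun v => locate ((l, l * q) :: bs) (l * q + v) = j) =
        fun v => l + locate bs v = j := by
      funext v
      rw [locate_cons_of_le (Nat.le_add_right _ _), Nat.add_sub_cancel_left]
    rw [wt_cons, Nat.count_add]
    simp_rw [outside]
    rw [inside, pointWeight]
    split_ifs with h
    · rw [Nat.count_of_forall_not fun v _ hv => by omega]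
      push_cast
      field_simp
      simp
    · have shift (v : ℕ) : l + locate bs v = j ↔ locate bs v = j - l := by omega
      simp only [shift, zero_add, ih hp.2 hd]

/-! ### Uniformly random bits -/

instance : IsProbabilityMeasure coinLaw := by unfold coinLaw; infer_instance

theorem coinLaw_real_cylinder (t : ℕ) (a : ℕ → Bool) :
    coinLaw.real {b | ∀ i < t, b i = a i} = (1 / 2) ^ t := by
  have h : {b : ℕ → Bool | ∀ i < t, b i = a i} =
      Set.pi (Finset.range t : Set ℕ) fun i => {a i} := by
    ext b; simp
  rw [measureReal_def, h, coinLaw, Measure.infinitePi_pi _ (fun i _ => measurableSet_singleton _)]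
  simp

theorem readBits_eq_iff {t u : ℕ} (hu : u < 2 ^ t) (b : ℕ → Bool) :
    readBits (fun i => (b i).toNat) t = u ↔ ∀ i < t, b i = u.testBit (t - 1 - i) := by
  induction t generalizing u with
  | zero =>
    obtain rfl : u = 0 := by simpa using hu
    simp [readBits]
  | succ t ih =>
    have digits : readBits (fun i => (b i).toNat) (t + 1) = u ↔
        readBits (fun i => (b i).toNat) t = u / 2 ∧ b t = u.testBit 0 := by
      rw [readBits, Nat.testBit_zero]
      cases b t <;> simp <;> omega
    rw [digits, ih (by rw [pow_succ] at hu; omega), Nat.forall_lt_succ_right, Nat.add_sub_cancel,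
      Nat.sub_self]
    refine and_congr_left fun _ => forall₂_congr fun i hi => ?_
    rw [← Nat.testBit_succ, show (t - 1 - i).succ = t - i by omega]

theorem coinLaw_real_readBits {t : ℕ} {S : Finset ℕ} (hS : ∀ u ∈ S, u < 2 ^ t) :
    coinLaw.real {b | readBits (fun i => (b i).toNat) t ∈ S} = S.card / 2 ^ t := by
  have h : {b : ℕ → Bool | readBits (fun i => (b i).toNat) t ∈ S} =
      ⋃ u ∈ S, {b | ∀ i < t, b i = u.testBit (t - 1 - i)} := by
    ext b
    simp only [Set.mem_ofPred_eq, Set.mem_iUnion, exists_prop]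
    exact ⟨fun hb => ⟨_, hb, (readBits_eq_iff (hS _ hb) b).1 rfl⟩,
      fun ⟨u, hu, hb⟩ => (readBits_eq_iff (hS u hu) b).2 hb ▸ hu⟩
  rw [h, measureReal_biUnion_finset]
  · simp_rw [coinLaw_real_cylinder]
    simp [div_eq_mul_inv]
  · intro u hu v hv huv
    rw [Function.onFun, Set.disjoint_left]
    intro b hbu hbv
    exact huv
      (((readBits_eq_iff (hS u hu) b).2 hbu).symm.trans ((readBits_eq_iff (hS v hv) b).2 hbv))
  · intro u _
    measurability

namespace Sampler

open Histogram

variable {H : Histogram} {t B : ℕ}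

theorem exists_runs (hp : ∀ b ∈ H.bins, 0 < b.1) (hw : wt H.bins = 2 ^ t)
    (hN : 2 * H.bins.length + 1 ≤ B) (hwB : 2 ^ t ≤ B) (hl : len H.bins ≤ B) (b : ℕ → Bool) :
    ∃ s, prog.Runs H.encode (fun i => (b i).toNat) s ∧
      s.bitOps ≤ (H.bins.length + t + 1) * (23 + 2 * B.size) * (1 + 2 * B.size) ∧
      s.out = [locate H.bins (readBits (fun i => (b i).toNat) t)] ∧ s.drawn = t :=
  (prog_spec (fun _ => Bool.toNat_le _) hp hw hN hwB hl).runs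

theorem coinLaw_real_runs (hp : ∀ b ∈ H.bins, 0 < b.1) (hd : ∀ b ∈ H.bins, b.1 ∣ b.2)
    (hw : wt H.bins = 2 ^ t) (j : ℕ) :
    coinLaw.real {b | ∃ s, prog.Runs H.encode (fun i => (b i).toNat) s ∧ s.out = [j]} =
      H.prob j := by
  let S := (Finset.range (wt H.bins)).filter (locate H.bins · = j)
  have hruns : {b : ℕ → Bool | ∃ s, prog.Runs H.encode (fun i => (b i).toNat) s ∧ s.out = [j]} =
      {b | readBits (fun i => (b i).toNat) t ∈ S} := by
    ext b
    obtain ⟨s, hs, -, hout, -⟩ := exists_runs hp hw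
      (show _ ≤ 2 * H.bins.length + 1 + 2 ^ t + len H.bins by omega) (by omega) (by omega) b
    have hlt : readBits (fun i => (b i).toNat) t < wt H.bins :=
      (readBits_lt (fun i => Bool.toNat_le (b i)) t).trans_eq hw.symm
    simp only [S, Set.mem_ofPred_eq, Finset.mem_filter, Finset.mem_range, hlt, true_and]
    refine ⟨fun ⟨s', hs', hout'⟩ => ?_, fun h => ⟨s, hs, by rw [hout, h]⟩⟩
    rw [hs'.deterministic hs, hout] at hout'
    exact List.head_eq_of_cons_eq hout'
  have hS : ∀ u ∈ S, u < 2 ^ t := fun u hu =>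
    (Finset.mem_range.1 (Finset.mem_filter.1 hu).1).trans_eq hw
  have htotal : (H.totalWeight : ℝ) = 2 ^ t := by exact_mod_cast hw
  rw [hruns, coinLaw_real_readBits hS, ← Nat.count_eq_card_filter_range, count_locate hp hd, prob,
    htotal]

theorem sampledBy {n : ℕ} {r T : ℝ} (hH : H.IsOver n) (hd : ∀ b ∈ H.bins, b.1 ∣ b.2)
    (hw : H.totalWeight = 2 ^ t) (hN : 2 * H.bins.length + 1 ≤ B) (hwB : 2 ^ t ≤ B)
    (hnB : n + 1 ≤ B) (hr : (t : ℝ) ≤ r)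
    (hT : (((H.bins.length + t + 1) * (23 + 2 * B.size) * (1 + 2 * B.size) : ℕ) : ℝ) ≤ T) :
    H.SampledBy n prog r T := by
  obtain ⟨hp, hn, -⟩ := hH
  refine ⟨fun b => ?_, fun j _ => coinLaw_real_runs hp hd hw j⟩
  obtain ⟨s, hs, hops, hout, hdrawn⟩ := exists_runs hp hw hN hwB (hn.trans_le hnB) b
  have hu : readBits (fun i => (b i).toNat) t < wt H.bins :=
    (readBits_lt (fun i => Bool.toNat_le (b i)) t).trans_eq hw.symm
  have hlt : locate H.bins (readBits (fun i => (b i).toNat) t) < n + 1 :=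
    (locate_lt_len hp hu).trans_eq hn
  exact ⟨s, hs, ⟨_, Nat.le_of_lt_succ hlt, hout⟩, hdrawn ▸ hr, (Nat.cast_le.2 hops).trans hT⟩

end Sampler

/-! ### The learned histogram -/

/-- The points at which the first `K` samples cut `{0, ..., n}` into intervals: each sample becomes
an interval of its own, and so does `n`. -/
def Breakpoint (y : ℕ → ℕ) (K n v : ℕ) : Prop := v = n ∨ ∃ i < K, v = y i ∨ v = y i + 1

/-- The smallest breakpoint above `a`. -/
noncomputable def nextBreakpoint (y : ℕ → ℕ) (K n a : ℕ) : ℕ :=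
  sInf {v | a < v ∧ Breakpoint y K n v}

/-- The number of samples in the interval `[a, b)` among the first `M`. -/
def sampleCount (y : ℕ → ℕ) (M a b : ℕ) : ℕ :=
  ((Finset.range M).filter fun i => a ≤ y i ∧ y i < b).card

/-- The weight of the interval `[a, b)`, namely `R` times its empirical probability, rounded down
to a multiple of its length. -/
def binWeight (y : ℕ → ℕ) (M R a b : ℕ) : ℕ :=
  (b - a) * (sampleCount y M a b * R / (M * (b - a)))

section nextBreakpoint

variable {y : ℕ → ℕ} {K n a : ℕ}

theorem isLeast_nextBreakpoint (y : ℕ → ℕ) (K : ℕ) (ha : a < n) :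
    IsLeast {v | a < v ∧ Breakpoint y K n v} (nextBreakpoint y K n a) :=
  ⟨Nat.sInf_mem ⟨n, ha, .inl rfl⟩, fun _ hv => Nat.sInf_le hv⟩

theorem lt_nextBreakpoint (y : ℕ → ℕ) (K : ℕ) (ha : a < n) : a < nextBreakpoint y K n a :=
  (isLeast_nextBreakpoint y K ha).1.1

theorem nextBreakpoint_le (y : ℕ → ℕ) (K : ℕ) (ha : a < n) : nextBreakpoint y K n a ≤ n :=
  (isLeast_nextBreakpoint y K ha).2 ⟨ha, .inl rfl⟩

theorem nextBreakpoint_zero (y : ℕ → ℕ) (ha : a < n) : nextBreakpoint y 0 n a = n := by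
  rcases (isLeast_nextBreakpoint y 0 ha).1.2 with h | ⟨i, hi, -⟩
  exacts [h, absurd hi (Nat.not_lt_zero i)]

theorem nextBreakpoint_succ (ha : a < n) :
    nextBreakpoint y (K + 1) n a =
      nextBreakpoint y K (if a ≤ y K then min n (max (y K) (a + 1)) else n) a := by
  set m := if a ≤ y K then min n (max (y K) (a + 1)) else n with hm
  have ham : a < m := by rw [hm]; split_ifs <;> omega
  have hmn : m ≤ n := by rw [hm]; split_ifs <;> omega
  have hmy : a ≤ y K → m ≤ max (y K) (a + 1) := fun h => by rw [hm, if_pos h]; omega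
  have hmb : Breakpoint y (K + 1) n m := by
    have : m = n ∨ m = y K ∨ m = y K + 1 := by rw [hm]; split_ifs <;> omega
    exact this.imp_right fun h => ⟨K, K.lt_succ_self, h⟩
  have hle := nextBreakpoint_le y K ham
  refine (isLeast_nextBreakpoint y (K + 1) ha).unique ⟨⟨lt_nextBreakpoint y K ham, ?_⟩, ?_⟩
  · rcases (isLeast_nextBreakpoint y K ham).1.2 with h | ⟨i, hi, h⟩
    exacts [h.symm ▸ hmb, .inr ⟨i, by omega, h⟩]
  · rintro v ⟨hav, rfl | ⟨i, hi, h⟩⟩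
    · exact hle.trans hmn
    · rcases Nat.lt_succ_iff_lt_or_eq.1 hi with hi | rfl
      · exact (isLeast_nextBreakpoint y K ham).2 ⟨hav, .inr ⟨i, hi, h⟩⟩
      · have := hmy (by omega)
        omega

end nextBreakpoint

section sampleCount

variable (y : ℕ → ℕ) (M R a b : ℕ)

theorem sampleCount_le : sampleCount y M a b ≤ M :=
  (Finset.card_filter_le _ _).trans_eq (Finset.card_range M)

theorem sampleCount_succ :
    sampleCount y (M + 1) a b = sampleCount y M a b + if a ≤ y M ∧ y M < b then 1 else 0 := by
  rw [sampleCount, sampleCount, ← Nat.count_eq_card_filter_range, ← Nat.count_eq_card_filter_range,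
    Nat.count_succ]

theorem sampleCount_add {a b c : ℕ} (hab : a ≤ b) (hbc : b ≤ c) :
    sampleCount y M a b + sampleCount y M b c = sampleCount y M a c := by
  induction M with
  | zero => rfl
  | succ M ih =>
    simp only [sampleCount_succ]
    split_ifs <;> omega

theorem mul_binWeight_le : M * binWeight y M R a b ≤ sampleCount y M a b * R := by
  rw [binWeight, ← mul_assoc]
  exact Nat.mul_div_le _ _

end sampleCount

/-- The bins of `{a, ..., n}` cut out by the breakpoints. The last bin `{n}` receives what remains
of the weight `r`, so that the rounding does not change the total weight. -/
noncomputable def bins (y : ℕ → ℕ) (K M R n : ℕ) (a r : ℕ) : List (ℕ × ℕ) :=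
  if a < n then
    (nextBreakpoint y K n a - a, binWeight y M R a (nextBreakpoint y K n a)) ::
      bins y K M R n (nextBreakpoint y K n a) (r - binWeight y M R a (nextBreakpoint y K n a))
  else [(1, r)]
termination_by n - a
decreasing_by
  have := lt_nextBreakpoint y K ‹a < n›
  omega

section bins

variable {y : ℕ → ℕ} {K M R n a r : ℕ}

theorem fst_pos_of_mem_bins : ∀ b ∈ bins y K M R n a r, 0 < b.1 := by
  fun_induction bins with
  | case1 a r ha ih =>
    exact List.forall_mem_cons.2 ⟨Nat.sub_pos_of_lt (lt_nextBreakpoint y K ha), ih⟩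
  | case2 => exact List.forall_mem_singleton.2 one_pos

theorem fst_dvd_snd_of_mem_bins : ∀ b ∈ bins y K M R n a r, b.1 ∣ b.2 := by
  fun_induction bins with
  | case1 _ _ _ ih => exact List.forall_mem_cons.2 ⟨Dvd.intro _ rfl, ih⟩
  | case2 => exact List.forall_mem_singleton.2 (one_dvd _)

theorem len_bins (ha : a ≤ n) : Histogram.len (bins y K M R n a r) = n + 1 - a := by
  fun_induction bins with
  | case1 a r hlt ih =>
    have := lt_nextBreakpoint y K hlt
    have := nextBreakpoint_le y K hlt
    rw [Histogram.len_cons, ih this]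
    dsimp only
    omega
  | case2 a r h =>
    rw [Histogram.len_cons, Histogram.len_nil]
    omega

theorem binWeight_le {b : ℕ} (hM : 0 < M) (hab : a ≤ b) (hbn : b ≤ n)
    (hr : sampleCount y M a n * R ≤ M * r) :
    binWeight y M R a b ≤ r ∧ sampleCount y M b n * R ≤ M * (r - binWeight y M R a b) := by
  have hadd := sampleCount_add y M hab hbn
  have hw := mul_binWeight_le y M R a b
  rw [← hadd, add_mul] at hr
  rw [Nat.mul_sub]
  exact ⟨Nat.le_of_mul_le_mul_left (by omega) hM, by omega⟩

theorem wt_bins (hM : 0 < M) (ha : a ≤ n) (hr : sampleCount y M a n * R ≤ M * r) :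
    Histogram.wt (bins y K M R n a r) = r := by
  fun_induction bins with
  | case1 a r hlt ih =>
    have hb := lt_nextBreakpoint y K hlt
    have hbn := nextBreakpoint_le y K hlt
    obtain ⟨hle, hr'⟩ := binWeight_le hM hb.le hbn hr
    rw [Histogram.wt_cons, ih hbn hr']
    exact Nat.add_sub_cancel' hle
  | case2 => rfl

open Classical in
theorem length_bins_le : (bins y K M R n a r).length ≤ 2 * K + 2 := by
  let S := insert n ((Finset.range K).image y ∪ (Finset.range K).image (y · + 1))
  have mem_S {v : ℕ} (hv : Breakpoint y K n v) : v ∈ S := by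
    rcases hv with rfl | ⟨i, hi, rfl | rfl⟩ <;> simp only [S, Finset.mem_insert, Finset.mem_union,
      Finset.mem_image, Finset.mem_range] <;> grind
  have card_S : S.card ≤ 2 * K + 1 := by
    have h₁ : ((Finset.range K).image y).card ≤ K :=
      Finset.card_image_le.trans_eq (Finset.card_range K)
    have h₂ : ((Finset.range K).image (y · + 1)).card ≤ K :=
      Finset.card_image_le.trans_eq (Finset.card_range K)
    have h₃ : S.card ≤ _ + 1 := Finset.card_insert_le n _
    have h₄ := Finset.card_union_le ((Finset.range K).image y) ((Finset.range K).image (y · + 1))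
    omega
  suffices (bins y K M R n a r).length ≤ (S.filter (a < ·)).card + 1 from
    this.trans (Nat.succ_le_succ ((Finset.card_filter_le _ _).trans card_S))
  fun_induction bins with
  | case1 a r ha ih =>
    have hb := lt_nextBreakpoint y K ha
    have hS := mem_S (isLeast_nextBreakpoint y K ha).1.2
    have hlt : (S.filter (nextBreakpoint y K n a < ·)).card < (S.filter (a < ·)).card :=
      Finset.card_lt_card (Finset.ssubset_iff_of_subset
        (Finset.monotone_filter_right S fun v _ hv => hb.trans hv) |>.2
        ⟨_, Finset.mem_filter.2 ⟨hS, hb⟩, fun h => lt_irrefl _ (Finset.mem_filter.1 h).2⟩)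
    rw [List.length_cons]
    omega
  | case2 => exact Nat.le_add_left 1 _

end bins

/-! ### The learner -/

/-- The number of samples whose empirical distribution function is, with probability at least
`19 / 20`, within `1 / A` of the true one. -/
def sampleSize (A : ℕ) : ℕ := 80 * A ^ 3

namespace Learner

/-- The reciprocal of the accuracy to which the samples that define the breakpoints determine the
distribution function. -/
def firstScale (E : ℕ) : ℕ := 128 * E ^ 2

/-- The number of samples that define the breakpoints. -/
def firstCount (E : ℕ) : ℕ := sampleSize (firstScale E)

/-- The reciprocal of the accuracy to which all samples determine the distribution function: the
error `1 / E` is shared out among the at most `2 * firstCount E + 1` bins other than `{n}`. -/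
def secondScale (E : ℕ) : ℕ := 8 * (2 * firstCount E + 1) * E

/-- The number of all samples, among them those that define the breakpoints. -/
def secondCount (E : ℕ) : ℕ := sampleSize (secondScale E)

/-- The binary logarithm of the total weight. -/
def weightLog (n E : ℕ) : ℕ := Nat.clog 2 (4 * n * E)

/-- The histogram learned from the samples `y`. -/
noncomputable def hypothesis (y : ℕ → ℕ) (n E : ℕ) : Histogram :=
  ⟨bins y (firstCount E) (secondCount E) (2 ^ weightLog n E) n 0 (2 ^ weightLog n E)⟩

/-- Put `sampleSize` of register `9` into register `x`. -/
def sizeInto (x : ℕ) : Prog := .straight [.mul 10 9 9, .mul 10 10 9, .const 11 80, .mul x 11 10]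

/-- Load the input and compute the number of the first samples. -/
def computeFirstCount : Prog :=
  .block [.straight [.const 2 1, .load 0 9, .load 1 2, .const 9 128, .mul 10 1 1, .mul 9 9 10],
    sizeInto 3]

/-- Compute the number of all samples. -/
def computeSecondCount : Prog :=
  .block [.straight [.add 9 3 3, .add 9 9 2, .const 11 8, .mul 9 11 9, .mul 9 9 1], sizeInto 4]

/-- Prepare the computation of the total weight. -/
def computeTarget : Prog :=
  .straight [.const 11 4, .mul 18 11 0, .mul 18 18 1, .const 5 1, .sub 13 18 5]

/-- Compute the parameters. The registers are allocated as follows: `0` holds `n`, `1` the input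
`E`, `2` the number one, `3` and `4` the two sample sizes, `5` the total weight, `18` the number
`4 * n * E`, `6` and `7` the ends of the current bin, `12` the number of its samples, `15` the
weight that remains, `19` the number of bins, and `8` and `13` control the loops. -/
def setup : Prog := .block [computeFirstCount, computeSecondCount, computeTarget]

/-- Double register `5` until it reaches register `18`. -/
def powerOfTwo : Prog := .loop 13 (.straight [.add 5 5 5, .sub 13 18 5])

/-- Store samples from address `8` on, as many as register `13` says. -/
def storeSamples : Prog := .loop 13 (.straight [.draw 9, .store 8 9, .add 8 8 2, .sub 13 13 2])

/-- Draw all samples. -/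
def drawSamples : Prog := .block [.straight [.const 8 0, .copy 13 4], storeSamples]

/-- Lower register `7` to the smallest breakpoint above register `6` that the sample numbered by
register `8` contributes. -/
def lowerBreakpoint : Prog :=
  .block [.straight [.sub 8 8 2, .load 9 8, .add 10 9 2, .sub 10 10 6],
    .cond 10 (.straight [.add 11 6 2, .sub 10 11 9, .add 9 9 10, .sub 10 7 9, .sub 7 7 10])
      (.straight [])]

/-- Put the next breakpoint after register `6` into register `7`. -/
def findNext : Prog := .block [.straight [.copy 7 0, .copy 8 3], .loop 8 lowerBreakpoint]

/-- Add to register `12` the number of the first samples, as many as register `8` says, in the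
current bin. -/
def addSamples : Prog :=
  .loop 8 (.straight [.sub 8 8 2, .load 9 8, .sub 10 6 9, .add 11 9 2, .sub 11 11 7, .add 10 10 11,
    .sub 10 2 10, .add 12 12 10])

/-- Put the number of samples in the current bin into register `12`. -/
def countSamples : Prog := .block [.straight [.const 12 0, .copy 8 4], addSamples]

/-- Go on to the next bin. -/
def advance : Prog := .straight [.copy 6 7, .sub 13 0 6]

/-- Start with the first bin. -/
def rewind : Prog := .straight [.const 6 0, .sub 13 0 6, .copy 15 5]

/-- Count a bin and go on to the next one. -/
def countNextBin : Prog := .block [findNext, .straight [.add 19 19 2], advance]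

/-- Add the number of bins but the last one to register `19`. -/
def countBins : Prog := .loop 13 countNextBin

/-- Output the length and the weight of the current bin. -/
def emitBin : Prog :=
  .straight [.sub 16 7 6, .mul 17 12 5, .mul 10 4 16, .div 17 17 10, .mul 17 16 17, .emit 16,
    .emit 17, .sub 15 15 17]

/-- Find and output a bin, and go on to the next one. -/
def emitNextBin : Prog := .block [findNext, countSamples, emitBin, advance]

/-- Output all bins but the last one. -/
def emitBins : Prog := .loop 13 emitNextBin

/-- Output the number of bins. -/
def emitLength : Prog :=
  .block [rewind, .straight [.const 19 1], countBins, .straight [.emit 19]]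

/-- Output all bins. -/
def emitAll : Prog := .block [rewind, emitBins, .straight [.emit 2, .emit 15]]

/-- The learner, which outputs the encoding of `hypothesis ω n E` on input `[n, E]`. -/
def prog : Prog := .block [setup, powerOfTwo, drawSamples, emitLength, emitAll]

/-- The parameters are in their registers and the samples in the memory. -/
structure Ready (ω : ℕ → ℕ) (n K M R : ℕ) (σ : Config) : Prop where
  domain : σ.reg 0 = n
  one : σ.reg 2 = 1
  first : σ.reg 3 = K
  count : σ.reg 4 = M
  total : σ.reg 5 = R
  samples : ∀ i < M, σ.mem i = ω i

variable {ω : ℕ → ℕ} {B n K M R : ℕ} {σ τ : Config}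

theorem Ready.of_frame {P : Prog} (h : Ready ω n K M R σ) (hf : P.Frame σ τ)
    (hr : ∀ r < 6, P.any (Op.writes r) = false) (hm : P.any Op.isStore = false) :
    Ready ω n K M R τ where
  domain := (hf.reg (hr 0 (by decide))).trans h.domain
  one := (hf.reg (hr 2 (by decide))).trans h.one
  first := (hf.reg (hr 3 (by decide))).trans h.first
  count := (hf.reg (hr 4 (by decide))).trans h.count
  total := (hf.reg (hr 5 (by decide))).trans h.total
  samples i hi := (congrFun (hf.mem hm) i).trans (h.samples i hi)

theorem powerOfTwo_spec {T i : ℕ} (h5 : σ.reg 5 = 2 ^ i) (h18 : σ.reg 18 = T)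
    (h13 : σ.reg 13 = T - 2 ^ i) (hi : i ≤ Nat.clog 2 T) (hB : 2 * T ≤ B) :
    Spec ω B powerOfTwo σ (3 * (Nat.clog 2 T - i) + 1) fun τ => τ.reg 5 = 2 ^ Nat.clog 2 T := by
  induction hk : Nat.clog 2 T - i generalizing i σ with
  | zero =>
    obtain rfl : i = Nat.clog 2 T := by omega
    exact .loop_done (by rw [h13, Nat.sub_eq_zero_of_le (Nat.le_pow_clog one_lt_two T)]) h5
  | succ k ih =>
    have hlt : 2 ^ i < T := (Nat.lt_clog_iff_pow_lt one_lt_two).1 (by omega)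
    have : 2 ^ (i + 1) = 2 ^ i + 2 ^ i := by ring
    have body : Op.Post ω B (fun τ => τ.reg 5 = 2 ^ (i + 1) ∧ τ.reg 13 = T - 2 ^ (i + 1))
        [.add 5 5 5, .sub 13 18 5] σ := by
      simp [h5, h18]
      omega
    exact Spec.weaken (.loop_step (k' := 3 * k + 1) (by omega) (by omega)
      (.straight (k := 2) body le_rfl) fun τ ⟨t5, t13⟩ hf =>
        ih t5 ((hf.reg rfl).trans h18) t13 (by omega) (by omega)) (by omega)

theorem storeSamples_spec {i j : ℕ} (hω : ∀ i, ω i ≤ B) (h2 : σ.reg 2 = 1) (h8 : σ.reg 8 = j)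
    (h13 : σ.reg 13 = i) (hd : σ.drawn = j) (hm : ∀ k < j, σ.mem k = ω k) (hB : i + j + 1 ≤ B) :
    Spec ω B storeSamples σ (5 * i + 1) fun τ =>
      (∀ k < i + j, τ.mem k = ω k) ∧ τ.drawn = i + j := by
  induction i generalizing j σ with
  | zero => exact .loop_done h13 (by rw [zero_add]; exact ⟨hm, hd⟩)
  | succ i ih =>
    have hj := hω j
    have body : Op.Post ω B (fun τ => τ.reg 8 = j + 1 ∧ τ.reg 13 = i ∧ τ.drawn = j + 1 ∧
        τ.mem = Function.update σ.mem j (ω j))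
        [.draw 9, .store 8 9, .add 8 8 2, .sub 13 13 2] σ := by
      simp [h2, h8, h13, hd]
      omega
    refine Spec.weaken (.loop_step (k' := 5 * i + 1) (by omega) (by omega)
      (.straight (k := 4) body le_rfl) fun τ ⟨t8, t13, td, tm⟩ hf => ?_) (by omega)
    refine (ih ((hf.reg rfl).trans h2) t8 t13 td (fun k hk => ?_) (by omega)).mono le_rfl
      fun υ hυ _ => by rwa [add_right_comm, add_assoc]
    rw [tm, Function.update_apply]
    split_ifs with h
    · rw [h]
    · exact hm k (by omega)

theorem drawSamples_spec (hω : ∀ i, ω i ≤ B) (h2 : σ.reg 2 = 1) (h4 : σ.reg 4 = M)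
    (hd : σ.drawn = 0) (hB : M + 1 ≤ B) :
    Spec ω B drawSamples σ (5 * M + 3) fun τ => (∀ k < M, τ.mem k = ω k) ∧ τ.drawn = M := by
  have start : Op.Post ω B (fun τ => τ.reg 8 = 0 ∧ τ.reg 13 = M) [.const 8 0, .copy 13 4] σ := by
    simp [h4]
    omega
  exact Spec.weaken (.cons (.straight (k := 2) start le_rfl) fun τ ⟨t8, t13⟩ hf =>
    .last (storeSamples_spec hω ((hf.reg rfl).trans h2) t8 t13 ((hf.drawn rfl).trans hd)
      (fun _ hk => absurd hk (Nat.not_lt_zero _)) (by omega))) (by omega)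

theorem lowerBreakpoint_spec {i y : ℕ} (h2 : σ.reg 2 = 1) (h8 : σ.reg 8 = i + 1)
    (hm : σ.mem i = y) (hi : i + 1 ≤ B) (hy : y + 1 ≤ B) (h6 : σ.reg 6 + 1 ≤ B)
    (h7 : σ.reg 7 ≤ B) :
    Spec ω B lowerBreakpoint σ 10 fun τ => τ.reg 8 = i ∧
      τ.reg 7 = if σ.reg 6 ≤ y then min (σ.reg 7) (max y (σ.reg 6 + 1)) else σ.reg 7 := by
  have fetch : Op.Post ω B (fun τ => τ.reg 8 = i ∧ τ.reg 9 = y ∧ τ.reg 10 = y + 1 - σ.reg 6)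
      [.sub 8 8 2, .load 9 8, .add 10 9 2, .sub 10 10 6] σ := by
    simp [h2, h8, hm]
    omega
  refine Spec.weaken (.cons (.straight (k := 4) fetch le_rfl) fun τ ⟨t8, t9, _⟩ hf =>
    .last (.cond (k := 5) (by omega) (fun h => ?_) fun h => ?_)) (by omega)
  · have t2 := (hf.reg (r := 2) rfl).trans h2
    have t6 := hf.reg (r := 6) rfl
    have t7 := hf.reg (r := 7) rfl
    rw [if_pos (by omega)]
    have lower : Op.Post ω B (fun υ => υ.reg 7 = min (σ.reg 7) (max y (σ.reg 6 + 1)))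
        [.add 11 6 2, .sub 10 11 9, .add 9 9 10, .sub 10 7 9, .sub 7 7 10] τ := by
      simp [t2, t6, t7, t9]
      omega
    exact (Spec.straight (k := 5) lower le_rfl).mono le_rfl fun υ hυ hf' =>
      ⟨(hf'.reg rfl).trans t8, hυ⟩
  · rw [if_neg (by omega)]
    exact .straight ⟨t8, hf.reg rfl⟩ (Nat.zero_le 5)

theorem findNext_spec (hσ : Ready ω n K M R σ) (hω : ∀ i, ω i ≤ n) (h6 : σ.reg 6 < n)
    (hK : K ≤ M) (hM : M ≤ B) (hn : n + 1 ≤ B) :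
    Spec ω B findNext σ (11 * K + 3) fun τ => τ.reg 7 = nextBreakpoint ω K n (σ.reg 6) := by
  have step : ∀ i ≤ K, ∀ τ : Config, τ.reg 8 = i → τ.reg 2 = 1 → τ.reg 6 = σ.reg 6 →
      τ.mem = σ.mem → σ.reg 6 < τ.reg 7 → τ.reg 7 ≤ n →
      Spec ω B (.loop 8 lowerBreakpoint) τ (11 * i + 1) fun υ =>
        υ.reg 7 = nextBreakpoint ω i (τ.reg 7) (σ.reg 6) := by
    intro i hi
    induction i with
    | zero => exact fun τ h8 _ _ _ h7 _ => .loop_done h8 (nextBreakpoint_zero ω h7).symm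
    | succ i ih =>
      intro τ h8 h2 ht6 hm h7 h7n
      have hy := hω i
      refine Spec.weaken (.loop_step (k' := 11 * i + 1) (by omega) (by omega)
        (lowerBreakpoint_spec (y := ω i) h2 h8 (by rw [hm, hσ.samples i (by omega)]) (by omega)
          (by omega) (by omega) (by omega)) fun υ ⟨u8, u7⟩ hf => ?_) (by omega)
      rw [nextBreakpoint_succ h7, ← ht6, ← u7, ht6]
      refine ih (by omega) υ u8 ((hf.reg rfl).trans h2) ((hf.reg rfl).trans ht6)
        ((hf.mem rfl).trans hm) ?_ ?_ <;> rw [u7] <;> split_ifs <;> omega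
  have start : Op.Post ω B (fun τ => τ.reg 7 = n ∧ τ.reg 8 = K) [.copy 7 0, .copy 8 3] σ := by
    simp [hσ.domain, hσ.first]
    omega
  exact Spec.weaken (.cons (.straight (k := 2) start le_rfl) fun τ ⟨t7, t8⟩ hf =>
    .last ((step K le_rfl τ t8 ((hf.reg rfl).trans hσ.one) (hf.reg rfl) (hf.mem rfl) (by omega)
      t7.le).mono le_rfl fun υ hυ _ => by rw [hυ, t7])) (by omega)

theorem addSamples_spec {i : ℕ} (h2 : σ.reg 2 = 1) (h8 : σ.reg 8 = i) (hm : ∀ k < i, σ.mem k = ω k)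
    (hω : ∀ i, ω i ≤ n) (h6 : σ.reg 6 ≤ n) (h7 : σ.reg 7 ≤ n) (hi : σ.reg 12 + i ≤ B)
    (hn : 2 * n + 2 ≤ B) :
    Spec ω B addSamples σ (9 * i + 1) fun τ =>
      τ.reg 12 = σ.reg 12 + sampleCount ω i (σ.reg 6) (σ.reg 7) := by
  induction i generalizing σ with
  | zero => exact .loop_done h8 rfl
  | succ i ih =>
    have hy := hω i
    have hmi := hm i i.lt_succ_self
    have body : Op.Post ω B (fun τ => τ.reg 8 = i ∧
        τ.reg 12 = σ.reg 12 + if σ.reg 6 ≤ ω i ∧ ω i < σ.reg 7 then 1 else 0)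
        [.sub 8 8 2, .load 9 8, .sub 10 6 9, .add 11 9 2, .sub 11 11 7, .add 10 10 11,
          .sub 10 2 10, .add 12 12 10] σ := by
      simp [h2, h8, hmi]
      split_ifs <;> omega
    refine Spec.weaken (.loop_step (k' := 9 * i + 1) (by omega) (by omega)
      (.straight (k := 8) body le_rfl) fun τ ⟨t8, t12⟩ hf => ?_) (by omega)
    have t6 := hf.reg (r := 6) rfl
    have t7 := hf.reg (r := 7) rfl
    refine (ih ((hf.reg rfl).trans h2) t8 (fun k hk => by rw [hf.mem rfl, hm k (by omega)])
      (by omega) (by omega) (by split_ifs at t12 <;> omega)).mono le_rfl fun υ hυ _ => ?_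
    rw [hυ, t12, t6, t7, sampleCount_succ]
    omega

theorem countSamples_spec (hσ : Ready ω n K M R σ) (hω : ∀ i, ω i ≤ n) (h6 : σ.reg 6 ≤ n)
    (h7 : σ.reg 7 ≤ n) (hM : M ≤ B) (hn : 2 * n + 2 ≤ B) :
    Spec ω B countSamples σ (9 * M + 3) fun τ =>
      τ.reg 12 = sampleCount ω M (σ.reg 6) (σ.reg 7) := by
  have start : Op.Post ω B (fun τ => τ.reg 12 = 0 ∧ τ.reg 8 = M) [.const 12 0, .copy 8 4] σ := by
    simp [hσ.count]
    omega
  refine Spec.weaken (.cons (.straight (k := 2) start le_rfl) fun τ ⟨t12, t8⟩ hf =>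
    .last (k := 9 * M + 1) ?_) (by omega)
  have t6 := hf.reg (r := 6) rfl
  have t7 := hf.reg (r := 7) rfl
  exact (addSamples_spec ((hf.reg rfl).trans hσ.one) t8
    (fun k hk => by rw [hf.mem rfl, hσ.samples k hk]) hω (by omega) (by omega) (by omega)
    hn).mono le_rfl fun υ hυ _ => by rw [hυ, t12, t6, t7, zero_add]

theorem advance_spec (h0 : σ.reg 0 = n) (hn : n ≤ B) (h7 : σ.reg 7 ≤ n) :
    Spec ω B advance σ 2 fun τ => τ.reg 6 = σ.reg 7 ∧ τ.reg 13 = n - σ.reg 7 := by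
  refine .straight ?_ le_rfl
  simp [h0]
  omega

theorem rewind_spec (h0 : σ.reg 0 = n) (h5 : σ.reg 5 = R) (hn : n ≤ B) (hR : R ≤ B) :
    Spec ω B rewind σ 3 fun τ => τ.reg 6 = 0 ∧ τ.reg 13 = n - 0 ∧ τ.reg 15 = R := by
  refine .straight ?_ le_rfl
  simp [h0, h5]
  omega

theorem countNextBin_spec {a : ℕ} (hσ : Ready ω n K M R σ) (hω : ∀ i, ω i ≤ n)
    (h6 : σ.reg 6 = a) (ha : a < n) (hK : K ≤ M) (hM : M ≤ B) (hn : n + 1 ≤ B)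
    (hB : σ.reg 19 + 1 ≤ B) :
    Spec ω B countNextBin σ (11 * K + 6) fun τ => τ.reg 6 = nextBreakpoint ω K n a ∧
      τ.reg 13 = n - nextBreakpoint ω K n a ∧ τ.reg 19 = σ.reg 19 + 1 := by
  have hb := nextBreakpoint_le ω K ha
  refine Spec.weaken (.cons (findNext_spec hσ hω (by omega) hK hM hn) fun σ₁ h7 f₁ =>
    .cons (k := 1) (Q := fun τ => τ.reg 19 = σ.reg 19 + 1) (.straight ?_ le_rfl)
      fun σ₂ h19 f₂ => .last (k := 2) ?_) (by omega)
  · simp [f₁.reg (r := 19) rfl, f₁.reg (r := 2) rfl, hσ.one]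
    omega
  · have h7' := (f₂.reg (r := 7) rfl).trans h7
    rw [h6] at h7'
    refine (advance_spec (n := n) ?_ (by omega) (by omega)).mono le_rfl
      fun τ ⟨t6, t13⟩ f₃ => ⟨by rw [t6, h7'], by rw [t13, h7'], (f₃.reg rfl).trans h19⟩
    rw [f₂.reg rfl, f₁.reg rfl, hσ.domain]

theorem countBins_spec {a r : ℕ} (hσ : Ready ω n K M R σ) (hω : ∀ i, ω i ≤ n)
    (h6 : σ.reg 6 = a) (h13 : σ.reg 13 = n - a) (hK : K ≤ M) (hM : M ≤ B) (hn : n + 1 ≤ B)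
    (hB : σ.reg 19 + (bins ω K M R n a r).length ≤ B) :
    Spec ω B countBins σ ((bins ω K M R n a r).length * (11 * K + 7)) fun τ =>
      τ.reg 19 + 1 = σ.reg 19 + (bins ω K M R n a r).length := by
  fun_induction bins ω K M R n a r generalizing σ with
  | case1 a r ha ih =>
    rw [List.length_cons] at hB ⊢
    refine Spec.weaken (.loop_step (by omega) (by omega)
      (countNextBin_spec hσ hω h6 ha hK hM hn (by omega)) fun τ ⟨t6, t13, _⟩ hf =>
        (ih (hσ.of_frame hf (by decide) rfl) t6 t13 (by omega)).mono le_rfl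
          fun υ hυ _ => ?_) (by rw [add_mul]; omega)
    omega
  | case2 a r ha =>
    have hdone : σ.reg 13 = 0 := by omega
    exact Spec.weaken (k := 1) (.loop_done hdone rfl) (by rw [List.length_singleton]; omega)

theorem emitBin_spec {a b : ℕ} (h4 : σ.reg 4 = M) (h5 : σ.reg 5 = R) (h6 : σ.reg 6 = a)
    (h7 : σ.reg 7 = b) (h12 : σ.reg 12 = sampleCount ω M a b) (h15 : σ.reg 15 ≤ B) (hM : 0 < M)
    (hab : a < b) (hbn : b ≤ n) (hMn : M * n ≤ B) (hMR : M * R ≤ B) :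
    Spec ω B emitBin σ (8 + 8 * B.size) fun τ =>
      τ.out = σ.out ++ [b - a, binWeight ω M R a b] ∧
        τ.reg 15 = σ.reg 15 - binWeight ω M R a b := by
  have hcount := sampleCount_le ω M a b
  have hcountR : sampleCount ω M a b * R ≤ M * R := Nat.mul_le_mul_right R hcount
  have hR : R ≤ M * R := Nat.le_mul_of_pos_left R hM
  have hn : n ≤ M * n := Nat.le_mul_of_pos_left n hM
  have hMM : M ≤ M * n := Nat.le_mul_of_pos_right M (by omega)
  have hlen : M * (b - a) ≤ M * n := Nat.mul_le_mul_left M (by omega)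
  have hdiv := Nat.div_le_self (sampleCount ω M a b * R) (M * (b - a))
  have hweight : binWeight ω M R a b ≤ M * R :=
    (Nat.le_mul_of_pos_left _ hM).trans ((mul_binWeight_le ω M R a b).trans hcountR)
  have fold : (b - a) * (sampleCount ω M a b * R / (M * (b - a))) = binWeight ω M R a b := rfl
  refine .straight ?_ (by simp [Op.units]; omega)
  simp [h4, h5, h6, h7, h12, fold]
  omega

theorem emitNextBin_spec {a r : ℕ} (hσ : Ready ω n K M R σ) (hω : ∀ i, ω i ≤ n)
    (h6 : σ.reg 6 = a) (ha : a < n) (h15 : σ.reg 15 = r) (hK : K ≤ M) (hM : 0 < M)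
    (hn : 2 * n + 2 ≤ B) (hMn : M * n ≤ B) (hMR : M * R ≤ B) (hr : r ≤ B) :
    Spec ω B emitNextBin σ (11 * K + 9 * M + 16 + 8 * B.size) fun τ =>
      τ.reg 6 = nextBreakpoint ω K n a ∧ τ.reg 13 = n - nextBreakpoint ω K n a ∧
        τ.reg 15 = r - binWeight ω M R a (nextBreakpoint ω K n a) ∧
        τ.out = σ.out ++ [nextBreakpoint ω K n a - a,
          binWeight ω M R a (nextBreakpoint ω K n a)] := by
  have hlt := lt_nextBreakpoint ω K ha
  have hb := nextBreakpoint_le ω K ha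
  have hMB : M ≤ B := (Nat.le_mul_of_pos_right M (by omega)).trans hMn
  refine Spec.weaken (.cons (findNext_spec hσ hω (by omega) hK hMB (by omega))
    fun σ₁ h7 f₁ => ?_) (k := 11 * K + 3 + (9 * M + 3 + (8 + 8 * B.size + 2))) (by omega)
  have r₁ : Ready ω n K M R σ₁ := hσ.of_frame f₁ (by decide) rfl
  have s6 := (f₁.reg (r := 6) rfl).trans h6
  rw [h6] at h7
  refine .cons (countSamples_spec r₁ hω (by omega) (by omega) hMB hn) fun σ₂ h12 f₂ => ?_
  have r₂ : Ready ω n K M R σ₂ := r₁.of_frame f₂ (by decide) rfl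
  rw [s6, h7] at h12
  have s7 := (f₂.reg (r := 7) rfl).trans h7
  have s15 := ((f₂.reg (r := 15) rfl).trans (f₁.reg rfl)).trans h15
  refine .cons (emitBin_spec r₂.count r₂.total ((f₂.reg rfl).trans s6) s7 h12 (by omega) hM
    hlt hb hMn hMR) fun σ₃ ⟨o₃, h15'⟩ f₃ => ?_
  have u7 := (f₃.reg (r := 7) rfl).trans s7
  refine .last ((advance_spec ((f₃.reg rfl).trans r₂.domain) (by omega) (by omega)).mono le_rfl
    fun τ ⟨t6, t13⟩ f₄ => ⟨by rw [t6, u7], by rw [t13, u7], ?_, ?_⟩)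
  · rw [f₄.reg rfl, h15', s15]
  · rw [f₄.out rfl, o₃, f₂.out rfl, f₁.out rfl]

theorem emitBins_spec {a r : ℕ} (hσ : Ready ω n K M R σ) (hω : ∀ i, ω i ≤ n)
    (h6 : σ.reg 6 = a) (h13 : σ.reg 13 = n - a) (h15 : σ.reg 15 = r) (hK : K ≤ M) (hM : 0 < M)
    (hn : 2 * n + 2 ≤ B) (hMn : M * n ≤ B) (hMR : M * R ≤ B) (hr : r ≤ B) :
    Spec ω B emitBins σ
      ((bins ω K M R n a r).length * (11 * K + 9 * M + 17 + 8 * B.size)) fun τ =>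
        τ.out ++ [1, τ.reg 15] = σ.out ++ (bins ω K M R n a r).flatMap (fun b => [b.1, b.2]) ∧
          τ.reg 15 ≤ r := by
  fun_induction bins ω K M R n a r generalizing σ with
  | case1 a r ha ih =>
    refine Spec.weaken (.loop_step (by omega) (by omega)
      (emitNextBin_spec hσ hω h6 ha h15 hK hM hn hMn hMR hr) fun τ ⟨t6, t13, t15, tout⟩ hf =>
        (ih (hσ.of_frame hf (by decide) rfl) t6 t13 t15 (by omega)).mono le_rfl
          fun υ ⟨uo, _⟩ _ => ⟨?_, by omega⟩) (by rw [List.length_cons, add_mul]; omega)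
    rw [uo, tout, List.flatMap_cons, List.append_assoc]
  | case2 a r ha =>
    have hdone : σ.reg 13 = 0 := by omega
    exact Spec.weaken (k := 1) (.loop_done hdone ⟨by rw [h15]; rfl, h15.le⟩)
      (by rw [List.length_singleton]; omega)

theorem emitLength_spec (hσ : Ready ω n K M R σ) (hω : ∀ i, ω i ≤ n) (hK : 2 * K + 3 ≤ M)
    (hM : M ≤ B) (hR : R ≤ B) (hn : n + 1 ≤ B) (r : ℕ) :
    Spec ω B emitLength σ ((bins ω K M R n 0 r).length * (11 * K + 7) + 5) fun τ =>
      τ.out = σ.out ++ [(bins ω K M R n 0 r).length] := by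
  have hlen : (bins ω K M R n 0 r).length ≤ 2 * K + 2 := length_bins_le
  refine Spec.weaken (.cons (rewind_spec hσ.domain hσ.total (by omega) hR)
    fun σ₁ ⟨h6, h13, _⟩ f₁ => .cons (k := 1) (Q := fun τ => τ.reg 19 = 1) (.straight ?_ le_rfl)
      fun σ₂ h19 f₂ => ?_) (k := 3 + (1 + ((bins ω K M R n 0 r).length * (11 * K + 7) + 1)))
        (by omega)
  · simp
    omega
  have r₂ := (hσ.of_frame f₁ (by decide) rfl).of_frame f₂ (by decide) rfl
  refine .cons (countBins_spec (r := r) r₂ hω ((f₂.reg rfl).trans h6) ((f₂.reg rfl).trans h13)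
    (by omega) hM hn (by omega)) fun σ₃ hlength f₃ => .last (.straight ?_ le_rfl)
  simp [f₃.out rfl, f₂.out rfl, f₁.out rfl]
  omega

theorem emitAll_spec (hσ : Ready ω n K M R σ) (hω : ∀ i, ω i ≤ n) (hK : K ≤ M) (hM : 0 < M)
    (hn : 2 * n + 2 ≤ B) (hMn : M * n ≤ B) (hMR : M * R ≤ B) :
    Spec ω B emitAll σ
      ((bins ω K M R n 0 R).length * (11 * K + 9 * M + 17 + 8 * B.size) + 5) fun τ =>
        τ.out = σ.out ++ (bins ω K M R n 0 R).flatMap fun b => [b.1, b.2] := by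
  have hR : R ≤ B := (Nat.le_mul_of_pos_left R hM).trans hMR
  refine Spec.weaken (.cons (rewind_spec hσ.domain hσ.total (by omega) hR)
    fun σ₁ ⟨h6, h13, h15⟩ f₁ => .cons (emitBins_spec (hσ.of_frame f₁ (by decide) rfl) hω h6 h13 h15
      hK hM hn hMn hMR hR) fun σ₂ ⟨hout, hr⟩ f₂ => .last (.straight (k := 2) ?_ le_rfl)) (by omega)
  rw [f₁.out rfl] at hout
  have hone : σ₂.reg 2 = 1 := by rw [f₂.reg rfl, f₁.reg rfl, hσ.one]
  simp [hone, ← hout]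
  omega

end Learner

theorem le_sampleSize (A : ℕ) : A ≤ sampleSize A := by
  have := Nat.le_self_pow three_ne_zero A
  rw [sampleSize]
  omega

namespace Learner

/-- A bound on all numbers that the learner handles. -/
def numberBound (n E : ℕ) : ℕ := 16 * n * E * secondCount E

variable {ω : ℕ → ℕ} {B n E : ℕ} {σ : Config}

section Bounds

theorem sq_le_firstCount (E : ℕ) : 128 * E ^ 2 ≤ firstCount E := le_sampleSize _

theorem firstCount_le_secondScale (hE : 0 < E) : 16 * firstCount E + 8 ≤ secondScale E := by
  have := Nat.le_mul_of_pos_right (8 * (2 * firstCount E + 1)) hE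
  rw [secondScale]
  omega

theorem secondScale_le_secondCount (E : ℕ) : secondScale E ≤ secondCount E := le_sampleSize _

theorem forty_le_secondCount (hE : 0 < E) : 40 ≤ secondCount E := by
  have := firstCount_le_secondScale hE
  have := Nat.pow_le_pow_left (show 1 ≤ secondScale E by omega) 3
  rw [secondCount, sampleSize]
  omega

theorem le_two_pow_weightLog (n E : ℕ) : 4 * n * E ≤ 2 ^ weightLog n E :=
  Nat.le_pow_clog one_lt_two _

theorem two_pow_weightLog_le (hn : 0 < n) (hE : 0 < E) : 2 ^ weightLog n E ≤ 8 * n * E := by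
  have hpos : 0 < n * E := Nat.mul_pos hn hE
  have hlog : 0 < weightLog n E := Nat.clog_pos one_lt_two (by rw [mul_assoc]; omega)
  have hlt : 2 ^ (weightLog n E - 1) < 4 * n * E :=
    Nat.pow_pred_clog_lt_self one_lt_two (by rw [mul_assoc]; omega)
  calc 2 ^ weightLog n E = 2 * 2 ^ (weightLog n E - 1) := by
        rw [← pow_succ', Nat.sub_add_cancel hlog]
    _ ≤ 2 * (4 * n * E) := by gcongr
    _ = 8 * n * E := by ring

theorem secondCount_mul_le (hE : 0 < E) : secondCount E * n ≤ numberBound n E :=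
  calc secondCount E * n = n * 1 * secondCount E := by ring
    _ ≤ 16 * n * E * secondCount E := by gcongr <;> omega

theorem secondCount_mul_two_pow_le (hn : 0 < n) (hE : 0 < E) :
    secondCount E * 2 ^ weightLog n E ≤ numberBound n E :=
  calc secondCount E * 2 ^ weightLog n E ≤ secondCount E * (8 * n * E) := by
        gcongr; exact two_pow_weightLog_le hn hE
    _ = 8 * n * E * secondCount E := by ring
    _ ≤ 16 * n * E * secondCount E := by gcongr; omega

theorem sixteen_mul_secondCount_le (hn : 0 < n) (hE : 0 < E) :
    16 * secondCount E ≤ numberBound n E := by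
  have := Nat.mul_pos hn hE
  rw [numberBound, mul_assoc 16]
  gcongr
  omega

theorem sixteen_mul_le_numberBound (hE : 0 < E) : 16 * n * E ≤ numberBound n E :=
  Nat.le_mul_of_pos_right _ (by have := forty_le_secondCount hE; omega)

theorem weightLog_le_size (hn : 0 < n) (hE : 0 < E) :
    weightLog n E ≤ (numberBound n E).size := by
  have hM := forty_le_secondCount hE
  have hle := (Nat.le_mul_of_pos_left (2 ^ weightLog n E) (by omega)).trans
    (secondCount_mul_two_pow_le hn hE)
  have := Nat.size_le_size hle
  rw [Nat.size_pow] at this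
  omega

theorem length_bins_hypothesis_le (y : ℕ → ℕ) (n : ℕ) (hE : 0 < E) :
    2 * (hypothesis y n E).bins.length + 1 ≤ secondCount E := by
  have hlen : (hypothesis y n E).bins.length ≤ 2 * firstCount E + 2 := length_bins_le
  have := firstCount_le_secondScale hE
  have := secondScale_le_secondCount E
  omega

end Bounds

theorem sizeInto_spec (x : ℕ) {A : ℕ} (h9 : σ.reg 9 = A) (hA : sampleSize A ≤ B) (hB : 80 ≤ B) :
    Spec ω B (sizeInto x) σ (4 + 3 * B.size) fun τ => τ.reg x = sampleSize A := by
  have hcube : A * A * A = A ^ 3 := by ring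
  have hsq : A * A ≤ A ^ 3 := hcube ▸ mul_assoc A A A ▸ Nat.mul_le_mul_left A (Nat.le_mul_self A)
  have hle := Nat.le_self_pow three_ne_zero A
  rw [sampleSize] at hA ⊢
  refine .straight ?_ (by simp [Op.units]; omega)
  simp [h9, hcube]
  omega

theorem computeFirstCount_spec (hn : n + 1 ≤ B) (hE : E + 1 ≤ B) (hK : firstCount E ≤ B)
    (hB : 128 ≤ B) :
    Spec ω B computeFirstCount (.init [n, E]) (10 + 5 * B.size) fun τ =>
      τ.reg 0 = n ∧ τ.reg 1 = E ∧ τ.reg 2 = 1 ∧ τ.reg 3 = firstCount E := by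
  have hzero (r : ℕ) : (Config.init [n, E]).reg r = 0 := rfl
  have hmem₀ : (Config.init [n, E]).mem 0 = n := rfl
  have hmem₁ : (Config.init [n, E]).mem 1 = E := rfl
  have := Nat.le_self_pow two_ne_zero E
  have hscale := sq_le_firstCount E
  have load : Op.Post ω B (fun τ => τ.reg 0 = n ∧ τ.reg 1 = E ∧ τ.reg 2 = 1 ∧
      τ.reg 9 = firstScale E)
      [.const 2 1, .load 0 9, .load 1 2, .const 9 128, .mul 10 1 1, .mul 9 9 10]
      (.init [n, E]) := by
    simp [hzero, hmem₀, hmem₁, firstScale, ← sq]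
    omega
  exact Spec.weaken (.cons (.straight (k := 6 + 2 * B.size) load (by simp [Op.units]; omega))
    fun σ₁ ⟨h0, h1, h2, h9⟩ _ => .last ((sizeInto_spec 3 h9 hK (by omega)).mono le_rfl
      fun τ h3 f₂ => ⟨(f₂.reg rfl).trans h0, (f₂.reg rfl).trans h1, (f₂.reg rfl).trans h2, h3⟩))
    (by omega)

theorem computeSecondCount_spec (h1 : σ.reg 1 = E) (h2 : σ.reg 2 = 1)
    (h3 : σ.reg 3 = firstCount E) (hE : 0 < E) (hM : secondCount E ≤ B) (hB : 80 ≤ B) :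
    Spec ω B computeSecondCount σ (9 + 5 * B.size) fun τ => τ.reg 4 = secondCount E := by
  have hscale := (secondScale_le_secondCount E).trans hM
  have hfactor := (Nat.le_mul_of_pos_right (8 * (2 * firstCount E + 1)) hE).trans hscale
  have hEscale := Nat.le_mul_of_pos_left E (show 0 < 8 * (2 * firstCount E + 1) by omega)
  rw [secondScale] at hscale
  have scale : Op.Post ω B (fun τ => τ.reg 9 = secondScale E)
      [.add 9 3 3, .add 9 9 2, .const 11 8, .mul 9 11 9, .mul 9 9 1] σ := by
    simp [h1, h2, h3, secondScale, ← two_mul]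
    omega
  exact Spec.weaken (.cons (.straight (k := 5 + 2 * B.size) scale (by simp [Op.units]; omega))
    fun σ₁ h9 _ => .last (sizeInto_spec 4 h9 hM hB)) (by omega)

theorem computeTarget_spec (h0 : σ.reg 0 = n) (h1 : σ.reg 1 = E) (hn : 0 < n)
    (hE : 0 < E) (hB : 4 * n * E ≤ B) (hB' : 4 ≤ B) :
    Spec ω B computeTarget σ (5 + 2 * B.size) fun τ =>
      τ.reg 5 = 1 ∧ τ.reg 18 = 4 * n * E ∧ τ.reg 13 = 4 * n * E - 1 := by
  have hnT := Nat.le_mul_of_pos_right (4 * n) hE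
  have hET := Nat.le_mul_of_pos_left E (show 0 < 4 * n by omega)
  refine .straight ?_ (by simp [Op.units]; omega)
  simp [h0, h1]
  omega

theorem setup_spec (hn : 0 < n) (hE : 0 < E) :
    Spec ω (numberBound n E) setup (.init [n, E]) (24 + 12 * (numberBound n E).size) fun τ =>
      τ.reg 0 = n ∧ τ.reg 2 = 1 ∧ τ.reg 3 = firstCount E ∧ τ.reg 4 = secondCount E ∧
        τ.reg 5 = 1 ∧ τ.reg 18 = 4 * n * E ∧ τ.reg 13 = 4 * n * E - 1 := by
  have hK := firstCount_le_secondScale hE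
  have hKM := secondScale_le_secondCount E
  have hsq := Nat.le_self_pow two_ne_zero E
  have hsqK := sq_le_firstCount E
  have hMB := (Nat.le_mul_of_pos_right _ hn).trans (secondCount_mul_le (n := n) hE)
  have hnB := (Nat.le_mul_of_pos_right _ hE).trans (sixteen_mul_le_numberBound (n := n) hE)
  have hTB : 4 * n * E ≤ numberBound n E :=
    le_trans (by gcongr; omega) (sixteen_mul_le_numberBound hE)
  refine Spec.weaken (.cons (computeFirstCount_spec (by omega) (by omega) (by omega) (by omega))
    fun σ₁ ⟨h0, h1, h2, h3⟩ _ => .cons (computeSecondCount_spec h1 h2 h3 hE hMB (by omega))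
      fun σ₂ h4 f₂ => .last (computeTarget_spec ((f₂.reg rfl).trans h0) ((f₂.reg rfl).trans h1)
        hn hE hTB (by omega) |>.mono le_rfl fun τ ht f₃ => ?_)) (by omega)
  exact ⟨by rw [f₃.reg rfl, f₂.reg rfl, h0], by rw [f₃.reg rfl, f₂.reg rfl, h2],
    by rw [f₃.reg rfl, f₂.reg rfl, h3], (f₃.reg rfl).trans h4, ht⟩

theorem cost_le {K L M s t : ℕ} (hK : 2 * K + 3 ≤ M) (hL : L ≤ M) (ht : t ≤ s)
    (hM : 40 ≤ M) :
    24 + 12 * s + (3 * t + 1 + (5 * M + 3 + (L * (11 * K + 7) + 5 +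
      (L * (11 * K + 9 * M + 17 + 8 * s) + 5)))) ≤ 100 * M * M * (1 + s) := by
  have hcount : L * (11 * K + 7) ≤ M * (12 * M) := Nat.mul_le_mul hL (by omega)
  have hemit : L * (11 * K + 9 * M + 17 + 8 * s) ≤ M * (22 * M + 8 * s) :=
    Nat.mul_le_mul hL (by omega)
  have hs : s ≤ M * s := Nat.le_mul_of_pos_left s (by omega)
  have hMs : M * s ≤ M * M * s := by gcongr; exact Nat.le_mul_of_pos_left M (by omega)
  nlinarith

theorem prog_spec (hn : 0 < n) (hE : 0 < E) (hω : ∀ i, ω i ≤ n) :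
    Spec ω (numberBound n E) prog (.init [n, E])
      (100 * secondCount E * secondCount E * (1 + (numberBound n E).size)) fun τ =>
        τ.out = (hypothesis ω n E).encode ∧ τ.drawn = secondCount E := by
  have hK := firstCount_le_secondScale hE
  have hKM := secondScale_le_secondCount E
  have hM := forty_le_secondCount hE
  have hMn := secondCount_mul_le (n := n) hE
  have hMR := secondCount_mul_two_pow_le hn hE
  have hRB := (Nat.le_mul_of_pos_left _ (by omega)).trans hMR
  have hMB := sixteen_mul_secondCount_le hn hE
  have hnB := (Nat.le_mul_of_pos_right _ hE).trans (sixteen_mul_le_numberBound (n := n) hE)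
  have hTB : 2 * (4 * n * E) ≤ numberBound n E :=
    le_trans (by rw [← mul_assoc, ← mul_assoc]; gcongr; omega) (sixteen_mul_le_numberBound hE)
  have hlen := length_bins_hypothesis_le ω n hE
  refine Spec.weaken (.cons (setup_spec hn hE) fun σ₁ ⟨h0, h2, h3, h4, h5, h18, h13⟩ f₁ =>
    .cons (powerOfTwo_spec (i := 0) h5 h18 h13 (Nat.zero_le _) hTB) fun σ₂ h5' f₂ =>
    .cons (drawSamples_spec (fun i => (hω i).trans (by omega)) ((f₂.reg rfl).trans h2)
      ((f₂.reg rfl).trans h4) ((f₂.drawn rfl).trans (f₁.drawn rfl)) (by omega))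
    fun σ₃ ⟨hmem, hdrawn⟩ f₃ => ?_) (cost_le (K := firstCount E) (by omega)
      (show (hypothesis ω n E).bins.length ≤ _ by omega) (weightLog_le_size hn hE) hM)
  have r₃ : Ready ω n (firstCount E) (secondCount E) (2 ^ weightLog n E) σ₃ :=
    ⟨by rw [f₃.reg rfl, f₂.reg rfl, h0], by rw [f₃.reg rfl, f₂.reg rfl, h2],
      by rw [f₃.reg rfl, f₂.reg rfl, h3], by rw [f₃.reg rfl, f₂.reg rfl, h4],
      (f₃.reg rfl).trans h5', hmem⟩
  refine .cons (emitLength_spec r₃ hω (by omega) (by omega) hRB (by omega) (2 ^ weightLog n E))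
    fun σ₄ ho₄ f₄ => .last ((emitAll_spec (r₃.of_frame f₄ (by decide) rfl) hω (by omega)
      (by omega) (by omega) hMn hMR).mono le_rfl fun τ ho f₅ => ⟨?_, ?_⟩)
  · rw [ho, ho₄, f₃.out rfl, f₂.out rfl, f₁.out rfl]
    rfl
  · rw [f₅.drawn rfl, f₄.drawn rfl, hdrawn]

end Learner

namespace Learner

section Hypothesis

variable (y : ℕ → ℕ) {n E : ℕ}

theorem totalWeight_hypothesis (n : ℕ) (hE : 0 < E) :
    (hypothesis y n E).totalWeight = 2 ^ weightLog n E :=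
  wt_bins (by have := forty_le_secondCount hE; omega) (Nat.zero_le n)
    (Nat.mul_le_mul_right _ (sampleCount_le y _ 0 n))

theorem hypothesis_isOver (n : ℕ) (hE : 0 < E) : (hypothesis y n E).IsOver n :=
  ⟨fst_pos_of_mem_bins, len_bins (Nat.zero_le n), by rw [totalWeight_hypothesis y n hE]; positivity⟩

theorem hypothesis_sampledBy (hn : 0 < n) (hE : 0 < E) {r t : ℝ} (hr : (weightLog n E : ℝ) ≤ r)
    (ht : (((secondCount E + (numberBound n E).size + 1) * (23 + 2 * (numberBound n E).size) *
      (1 + 2 * (numberBound n E).size) : ℕ) : ℝ) ≤ t) :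
    (hypothesis y n E).SampledBy n Sampler.prog r t := by
  have hlen := length_bins_hypothesis_le y n hE
  have hM := sixteen_mul_secondCount_le hn hE
  have hR := (Nat.le_mul_of_pos_left (2 ^ weightLog n E)
    (by have := forty_le_secondCount hE; omega)).trans (secondCount_mul_two_pow_le hn hE)
  have hnB := (Nat.le_mul_of_pos_right _ hE).trans (sixteen_mul_le_numberBound (n := n) hE)
  refine Sampler.sampledBy (hypothesis_isOver y n hE) fst_dvd_snd_of_mem_bins
    (totalWeight_hypothesis y n hE) (by omega) hR (by omega) hr ((Nat.cast_le.2 ?_).trans ht)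
  gcongr
  · omega
  · exact weightLog_le_size hn hE

theorem exists_runs {ω : ℕ → ℕ} (hn : 0 < n) (hE : 0 < E) (hω : ∀ i, ω i ≤ n) :
    ∃ s, prog.Runs [n, E] ω s ∧ s.bitOps ≤ 100 * secondCount E * secondCount E *
        (1 + (numberBound n E).size) * (1 + 2 * (numberBound n E).size) ∧
      s.out = (hypothesis ω n E).encode ∧ s.drawn = secondCount E :=
  (prog_spec hn hE hω).runs

end Hypothesis

/-! ### Asymptotic costs -/

section Asymptotics

open Real

variable {n : ℕ} {x : ℝ}

theorem secondCount_le {E : ℕ} (hE : 0 < E) : secondCount E ≤ 2 ^ 101 * E ^ 21 := by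
  have hpow : 1 ≤ E ^ 6 := Nat.one_le_pow _ _ hE
  calc secondCount E = 80 * (8 * (2 * (80 * 128 ^ 3 * E ^ 6) + 1) * E) ^ 3 := by
        rw [secondCount, secondScale, firstCount, firstScale, sampleSize, sampleSize]
        ring
    _ ≤ 80 * (8 * (2 * (80 * 128 ^ 3 * E ^ 6) + E ^ 6) * E) ^ 3 := by gcongr
    _ = 80 * (8 * (2 * (80 * 128 ^ 3) + 1)) ^ 3 * E ^ 21 := by ring
    _ ≤ 2 ^ 101 * E ^ 21 := by gcongr; norm_num

theorem size_mul_log_two_le {N : ℕ} (hN : 0 < N) : N.size * log 2 ≤ log 2 + log N := by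
  obtain ⟨k, hk⟩ := Nat.exists_eq_succ_of_ne_zero (Nat.size_pos.2 hN).ne'
  have hpow : (2 : ℝ) ^ k ≤ N := by exact_mod_cast Nat.lt_size.1 (hk ▸ k.lt_succ_self)
  have hlog := log_le_log (by positivity) hpow
  rw [log_pow] at hlog
  rw [hk]
  push_cast
  linarith

theorem half_le_log (hn : 2 ≤ n) : 1 / 2 ≤ log n := by
  have := log_le_log two_pos (show (2 : ℝ) ≤ n by exact_mod_cast hn)
  linarith [log_two_gt_d9]

theorem ceil_le_two_mul (hx : 1 ≤ x) : (⌈x⌉₊ : ℝ) ≤ 2 * x := by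
  linarith [Nat.ceil_lt_add_one (zero_le_one.trans hx)]

theorem secondCount_ceil_le (hx : 1 ≤ x) : (secondCount ⌈x⌉₊ : ℝ) ≤ 2 ^ 122 * x ^ 21 :=
  calc (secondCount ⌈x⌉₊ : ℝ) ≤ 2 ^ 101 * (⌈x⌉₊ : ℝ) ^ 21 := by
        exact_mod_cast secondCount_le (Nat.ceil_pos.2 (one_pos.trans_le hx))
    _ ≤ 2 ^ 101 * (2 * x) ^ 21 := by gcongr; exact ceil_le_two_mul hx
    _ = 2 ^ 122 * x ^ 21 := by ring

theorem one_add_size_numberBound_le (hn : 2 ≤ n) (hx : 1 ≤ x) :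
    1 + ((numberBound n ⌈x⌉₊).size : ℝ) ≤ 400 * log n * x := by
  have hE : 0 < ⌈x⌉₊ := Nat.ceil_pos.2 (one_pos.trans_le hx)
  have hM := forty_le_secondCount hE
  have : 0 < n := by omega
  have hB : 0 < numberBound n ⌈x⌉₊ := by rw [numberBound]; positivity
  have hle : (numberBound n ⌈x⌉₊ : ℝ) ≤ 2 ^ 105 * n * (⌈x⌉₊ : ℝ) ^ 22 := by
    calc (numberBound n ⌈x⌉₊ : ℝ) ≤ 16 * n * ⌈x⌉₊ * (2 ^ 101 * (⌈x⌉₊ : ℝ) ^ 21) := by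
          exact_mod_cast Nat.mul_le_mul_left _ (secondCount_le hE)
      _ = 2 ^ 105 * n * (⌈x⌉₊ : ℝ) ^ 22 := by ring
  have hlog := log_le_log (by positivity) hle
  rw [log_mul (by positivity) (by positivity), log_mul (by positivity) (by positivity), log_pow,
    log_pow] at hlog
  push_cast at hlog
  have hsize := size_mul_log_two_le hB
  have hlogE := (log_le_self (Nat.cast_nonneg ⌈x⌉₊)).trans (ceil_le_two_mul hx)
  have hlog2 := log_two_gt_d9
  have hlog2' := log_two_lt_d9
  have hL := half_le_log hn
  nlinarith

theorem weightLog_ceil_le (hn : 2 ≤ n) (hx : 1 ≤ x) :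
    (weightLog n ⌈x⌉₊ : ℝ) ≤ 10 ^ 82 * log (n * x) := by
  have hn2 : (2 : ℝ) ≤ n := by exact_mod_cast hn
  have hE : 0 < ⌈x⌉₊ := Nat.ceil_pos.2 (one_pos.trans_le hx)
  have hle : (2 : ℝ) ^ weightLog n ⌈x⌉₊ ≤ 2 ^ 4 * (n * x) :=
    calc (2 : ℝ) ^ weightLog n ⌈x⌉₊ ≤ 8 * n * ⌈x⌉₊ := by
          exact_mod_cast two_pow_weightLog_le (by omega) hE
      _ ≤ 8 * n * (2 * x) := by gcongr; exact ceil_le_two_mul hx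
      _ = 2 ^ 4 * (n * x) := by ring
  have hlog := log_le_log (by positivity) hle
  rw [log_pow, log_mul (by positivity) (by positivity), log_pow] at hlog
  push_cast at hlog
  have h2 : log 2 ≤ log (n * x) := log_le_log two_pos (by nlinarith)
  have hw : (weightLog n ⌈x⌉₊ : ℝ) * (1 / 2) ≤ weightLog n ⌈x⌉₊ * log 2 := by
    gcongr
    linarith [log_two_gt_d9]
  linarith

theorem secondCount_le_log_mul (hn : 2 ≤ n) (hx : 1 ≤ x) :
    (secondCount ⌈x⌉₊ : ℝ) ≤ 10 ^ 82 * log n * x ^ 44 := by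
  have hL := half_le_log hn
  calc (secondCount ⌈x⌉₊ : ℝ) ≤ 2 ^ 122 * x ^ 21 := secondCount_ceil_le hx
    _ ≤ 2 ^ 122 * x ^ 44 * (2 * log n) := by
      rw [mul_assoc]
      gcongr
      exact (pow_le_pow_right₀ hx (by norm_num)).trans
        (le_mul_of_one_le_right (by positivity) (by linarith))
    _ = 2 ^ 123 * log n * x ^ 44 := by ring
    _ ≤ 10 ^ 82 * log n * x ^ 44 := by gcongr; norm_num

theorem learner_cost_le (hn : 2 ≤ n) (hx : 1 ≤ x) :
    ((100 * secondCount ⌈x⌉₊ * secondCount ⌈x⌉₊ * (1 + (numberBound n ⌈x⌉₊).size) *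
      (1 + 2 * (numberBound n ⌈x⌉₊).size) : ℕ) : ℝ) ≤ 10 ^ 82 * log n ^ 2 * x ^ 44 := by
  have hM := secondCount_ceil_le hx
  have hs := one_add_size_numberBound_le hn hx
  have : 0 ≤ log n := log_natCast_nonneg n
  push_cast
  calc 100 * (secondCount ⌈x⌉₊ : ℝ) * secondCount ⌈x⌉₊ * (1 + (numberBound n ⌈x⌉₊).size) *
        (1 + 2 * (numberBound n ⌈x⌉₊).size)
      ≤ 100 * (2 ^ 122 * x ^ 21) * (2 ^ 122 * x ^ 21) * (400 * log n * x) *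
        (2 * (400 * log n * x)) := by gcongr; linarith
    _ = 32000000 * 2 ^ 244 * log n ^ 2 * x ^ 44 := by ring
    _ ≤ 10 ^ 82 * log n ^ 2 * x ^ 44 := by gcongr; norm_num

theorem sampler_cost_le (hn : 2 ≤ n) (hx : 1 ≤ x) :
    (((secondCount ⌈x⌉₊ + (numberBound n ⌈x⌉₊).size + 1) *
      (23 + 2 * (numberBound n ⌈x⌉₊).size) * (1 + 2 * (numberBound n ⌈x⌉₊).size) : ℕ) : ℝ) ≤
      10 ^ 82 * (log n + x) ^ 44 := by
  have hL : 0 ≤ log n := log_natCast_nonneg n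
  have hM : (secondCount ⌈x⌉₊ : ℝ) ≤ 2 ^ 122 * (log n + x) ^ 21 :=
    (secondCount_ceil_le hx).trans (by gcongr; linarith)
  have hs : 1 + ((numberBound n ⌈x⌉₊).size : ℝ) ≤ 400 * (log n + x) ^ 2 :=
    (one_add_size_numberBound_le hn hx).trans (by nlinarith)
  have hz : 1 ≤ log n + x := by linarith
  have hs' : 1 + ((numberBound n ⌈x⌉₊).size : ℝ) ≤ 400 * (log n + x) ^ 21 :=
    hs.trans (by gcongr; norm_num)
  push_cast
  calc ((secondCount ⌈x⌉₊ : ℝ) + (numberBound n ⌈x⌉₊).size + 1) *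
        (23 + 2 * (numberBound n ⌈x⌉₊).size) * (1 + 2 * (numberBound n ⌈x⌉₊).size)
      ≤ ((2 ^ 122 + 400) * (log n + x) ^ 21) * (23 * (400 * (log n + x) ^ 2)) *
        (2 * (400 * (log n + x) ^ 2)) := by gcongr <;> linarith
    _ = 7360000 * (2 ^ 122 + 400) * (log n + x) ^ 25 := by ring
    _ ≤ 10 ^ 82 * (log n + x) ^ 44 := by gcongr <;> norm_num

end Asymptotics

end Learner

/-! ### Log-concavity of Poisson binomial distributions -/

/-- Log-concavity of a nonnegative function on `ℕ` or `ℤ`, in a form that excludes internal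
zeros. -/
structure LogConcave {G : Type*} [Add G] [Zero G] [LE G] (f : G → ℝ) : Prop where
  nonneg : ∀ i, 0 ≤ f i
  mul_le : ∀ {i j k : G}, i ≤ j → 0 ≤ k → f i * f (j + k) ≤ f j * f (i + k)

theorem LogConcave.add_mul_shift {f : ℤ → ℝ} (hf : LogConcave f) {q p : ℝ} (hq : 0 ≤ q)
    (hp : 0 ≤ p) : LogConcave fun z => q * f z + p * f (z - 1) where
  nonneg z := add_nonneg (mul_nonneg hq (hf.nonneg z)) (mul_nonneg hp (hf.nonneg (z - 1)))
  mul_le {i j k} hij hk := by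
    rcases hij.eq_or_lt with rfl | hij'
    · rfl
    rcases hk.eq_or_lt with rfl | hk'
    · rw [add_zero, add_zero, mul_comm]
    have h₀₀ := hf.mul_le hij hk
    have h₁₁ := hf.mul_le (sub_le_sub_right hij 1) hk
    have h₀₁ := hf.mul_le hij (k := k - 1) (by omega)
    have h₁₀ := hf.mul_le (i := i - 1) (j := j - 1) (k := k + 1) (by omega) (by omega)
    rw [sub_add_eq_add_sub, sub_add_eq_add_sub] at h₁₁
    rw [← add_sub_assoc, ← add_sub_assoc] at h₀₁
    rw [show j - 1 + (k + 1) = j + k by ring, show i - 1 + (k + 1) = i + k by ring] at h₁₀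
    have hqq := mul_le_mul_of_nonneg_left h₀₀ (mul_nonneg hq hq)
    have hpp := mul_le_mul_of_nonneg_left h₁₁ (mul_nonneg hp hp)
    have hqp := mul_le_mul_of_nonneg_left (add_le_add h₀₁ h₁₀) (mul_nonneg hq hp)
    linarith

/-- The coefficients of a polynomial, with zeros at the negative integers. -/
noncomputable def intCoeff (P : Polynomial ℝ) (z : ℤ) : ℝ :=
  if 0 ≤ z then P.coeff z.toNat else 0

theorem intCoeff_natCast (P : Polynomial ℝ) (j : ℕ) : intCoeff P j = P.coeff j := by
  rw [intCoeff, if_pos (Int.natCast_nonneg j), Int.toNat_natCast]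

theorem intCoeff_one (z : ℤ) : intCoeff 1 z = if z = 0 then 1 else 0 := by
  rw [intCoeff, Polynomial.coeff_one]
  split_ifs <;> first | rfl | omega

open Polynomial in
theorem intCoeff_linear_mul (P : Polynomial ℝ) (q p : ℝ) (z : ℤ) :
    intCoeff ((C q + C p * X) * P) z = q * intCoeff P z + p * intCoeff P (z - 1) := by
  rcases lt_trichotomy z 0 with h | rfl | h
  · simp [intCoeff, h.not_ge, show ¬1 ≤ z by omega]
  · simp [intCoeff, mul_coeff_zero]
  · obtain ⟨k, rfl⟩ : ∃ k : ℕ, z = (k + 1 : ℕ) := ⟨(z - 1).toNat, by omega⟩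
    rw [Nat.cast_succ, add_sub_cancel_right, ← Nat.cast_succ]
    simp only [intCoeff_natCast, add_mul, coeff_add, mul_assoc, coeff_C_mul, coeff_X_mul]

theorem logConcave_intCoeff_one : LogConcave (intCoeff 1) where
  nonneg z := by rw [intCoeff_one]; split_ifs <;> norm_num
  mul_le hij hk := by
    simp only [intCoeff_one]
    split_ifs <;> first | omega | norm_num

section BernoulliPoly

variable {n : ℕ} (p : Fin n → unitInterval)

open Polynomial in
/-- The generating polynomial of a sum of independent Bernoulli variables. -/
noncomputable def bernoulliPoly : Polynomial ℝ :=
  ∏ i, (C (1 - (p i : ℝ)) + C (p i : ℝ) * X)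

theorem productBits_real_singleton (x : Fin n → Bool) :
    (productBits p).real {x} = ∏ i, if x i then (p i : ℝ) else 1 - p i := by
  rw [productBits, measureReal_def, Measure.pi_singleton, ENNReal.toReal_prod]
  refine Finset.prod_congr rfl fun i _ => ?_
  rw [← measureReal_def, bernoulliMeasure_real_apply _ (measurableSet_singleton _)]
  cases x i <;> simp

open Polynomial in
theorem bernoulliPoly_eq_sum :
    bernoulliPoly p = ∑ x : Fin n → Bool, C ((productBits p).real {x}) * X ^ bitSum x := by
  have factor (i : Fin n) : C (1 - (p i : ℝ)) + C (p i : ℝ) * X =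
      ∑ b : Bool, C (if b then (p i : ℝ) else 1 - p i) * X ^ b.toNat := by
    simp [add_comm]
  rw [bernoulliPoly, Finset.prod_congr rfl fun i _ => factor i, Finset.prod_univ_sum,
    Fintype.piFinset_univ]
  refine Finset.sum_congr rfl fun x _ => ?_
  rw [Finset.prod_mul_distrib, Finset.prod_pow_eq_pow_sum, productBits_real_singleton, bitSum,
    map_prod]

theorem sumOfBernoullis_real_singleton (j : ℕ) :
    (sumOfBernoullis p).real {j} = (bernoulliPoly p).coeff j := by
  have hpre : (bitSum ⁻¹' {j} : Set (Fin n → Bool)) =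
      (Finset.univ.filter fun x => bitSum x = j : Finset (Fin n → Bool)) := by
    ext x; simp
  rw [sumOfBernoullis, map_measureReal_apply (measurable_of_countable _)
    (measurableSet_singleton _), bernoulliPoly_eq_sum, Polynomial.finsetSum_coeff, hpre,
    ← sum_measureReal_singleton, Finset.sum_filter]
  refine Finset.sum_congr rfl fun x _ => ?_
  rw [Polynomial.coeff_C_mul_X_pow]
  simp only [eq_comm]

theorem logConcave_intCoeff_bernoulliPoly : LogConcave (intCoeff (bernoulliPoly p)) := by
  rw [bernoulliPoly]
  induction (Finset.univ : Finset (Fin n)) using Finset.induction_on with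
  | empty => exact logConcave_intCoeff_one
  | insert i s hi ih =>
    rw [Finset.prod_insert hi, funext (intCoeff_linear_mul _ _ _)]
    exact ih.add_mul_shift (sub_nonneg.2 (p i).2.2) (p i).2.1

theorem sumOfBernoullis_logConcave : LogConcave fun j => (sumOfBernoullis p).real {j} where
  nonneg _ := measureReal_nonneg
  mul_le {i j k} hij _ := by
    have h := (logConcave_intCoeff_bernoulliPoly p).mul_le (Nat.cast_le.2 hij) (Nat.cast_nonneg k)
    simp only [← Nat.cast_add, intCoeff_natCast] at h
    simpa only [sumOfBernoullis_real_singleton] using h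

theorem bitSum_le (x : Fin n → Bool) : bitSum x ≤ n :=
  (Finset.sum_le_sum fun i _ => Bool.toNat_le (x i)).trans (by simp)

theorem sumOfBernoullis_ae_le : ∀ᵐ j ∂sumOfBernoullis p, j ≤ n := by
  rw [sumOfBernoullis, ae_map_iff (measurable_of_countable _).aemeasurable
    (Set.to_countable _).measurableSet]
  exact .of_forall bitSum_le

end BernoulliPoly

/-! ### Empirical distribution functions -/

/-- The fraction of the first `m` samples that lie strictly below `x`. -/
noncomputable def empiricalCDF (y : ℕ → ℕ) (m x : ℕ) : ℝ := sampleCount y m 0 x / m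

section empiricalCDF

variable (y : ℕ → ℕ) (m : ℕ)

theorem empiricalCDF_nonneg (x : ℕ) : 0 ≤ empiricalCDF y m x :=
  div_nonneg (Nat.cast_nonneg _) (Nat.cast_nonneg _)

theorem empiricalCDF_le_one (x : ℕ) : empiricalCDF y m x ≤ 1 :=
  div_le_one_of_le₀ (Nat.cast_le.2 (sampleCount_le y m 0 x)) (Nat.cast_nonneg _)

theorem empiricalCDF_sub {a b : ℕ} (hab : a ≤ b) :
    empiricalCDF y m b - empiricalCDF y m a = sampleCount y m a b / m := by
  rw [empiricalCDF, empiricalCDF, ← sampleCount_add y m (Nat.zero_le a) hab, ← sub_div,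
    Nat.cast_add, add_sub_cancel_left]

theorem empiricalCDF_mono : Monotone (empiricalCDF y m) := fun _ _ hab =>
  sub_nonneg.1 ((empiricalCDF_sub y m hab).symm ▸ by positivity)

theorem empiricalCDF_eq_sum (x : ℕ) :
    empiricalCDF y m x = (∑ i ∈ Finset.range m, (Set.Iio x).indicator 1 (y i)) / m := by
  simp only [empiricalCDF, sampleCount, Nat.zero_le, true_and, Finset.card_filter, Nat.cast_sum,
    Nat.cast_ite, Nat.cast_one, Nat.cast_zero, Set.indicator_apply, Set.mem_Iio, Pi.one_apply]

end empiricalCDF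

section Chebyshev

variable {Ω : Type*} [MeasurableSpace Ω] (μ : Measure Ω) [IsProbabilityMeasure μ] {f : Ω → ℝ}

theorem integral_sum_infinitePi (hf : Integrable f μ) (m : ℕ) :
    ∫ ω, ∑ i ∈ Finset.range m, f (ω i) ∂(Measure.infinitePi fun _ : ℕ => μ) =
      m * ∫ x, f x ∂μ := by
  have eval (i : ℕ) := measurePreserving_eval_infinitePi (fun _ : ℕ => μ) i
  have integral_eval (i : ℕ) :
      ∫ ω, f (ω i) ∂(Measure.infinitePi fun _ : ℕ => μ) = ∫ x, f x ∂μ := by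
    rw [← integral_map (φ := Function.eval i) (measurable_pi_apply i).aemeasurable
      ((eval i).map_eq.symm ▸ hf.aestronglyMeasurable), (eval i).map_eq]
  rw [integral_finsetSum _ fun i _ => by exact (eval i).integrable_comp_of_integrable hf]
  simp only [integral_eval, Finset.sum_const, Finset.card_range, nsmul_eq_mul]

theorem memLp_eval_infinitePi {p : ENNReal} (hf : MemLp f p μ) (i : ℕ) :
    MemLp (fun ω : ℕ → Ω => f (ω i)) p (Measure.infinitePi fun _ : ℕ => μ) :=
  hf.comp_measurePreserving (measurePreserving_eval_infinitePi (fun _ : ℕ => μ) i)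

theorem variance_sum_infinitePi (hf : Measurable f) (hf2 : MemLp f 2 μ) (m : ℕ) :
    variance (∑ i ∈ Finset.range m, fun ω : ℕ → Ω => f (ω i))
      (Measure.infinitePi fun _ : ℕ => μ) = m * variance f μ := by
  have indep := iIndepFun_infinitePi (P := fun _ : ℕ => μ) (X := fun _ => f) fun _ => hf
  have variance_eval (i : ℕ) :
      variance (fun ω : ℕ → Ω => f (ω i)) (Measure.infinitePi fun _ : ℕ => μ) = variance f μ :=
    (measurePreserving_eval_infinitePi (fun _ : ℕ => μ) i).variance_fun_comp hf.aemeasurable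
  rw [IndepFun.variance_sum (fun i _ => memLp_eval_infinitePi μ hf2 i)
    fun i _ j _ hij => indep.indepFun hij]
  simp only [variance_eval, Finset.sum_const, Finset.card_range, nsmul_eq_mul]

theorem infinitePi_real_le_abs_average_sub (hf : Measurable f) (hf2 : MemLp f 2 μ) {m : ℕ}
    (hm : 0 < m) {c : ℝ} (hc : 0 < c) :
    (Measure.infinitePi fun _ : ℕ => μ).real
      {ω : ℕ → Ω | c ≤ |(∑ i ∈ Finset.range m, f (ω i)) / m - ∫ x, f x ∂μ|} ≤
        variance f μ / (m * c ^ 2) := by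
  have hm' : (0 : ℝ) < m := Nat.cast_pos.2 hm
  have chebyshev := meas_ge_le_variance_div_sq
    (memLp_finsetSum' (Finset.range m) fun i _ => memLp_eval_infinitePi μ hf2 i) (mul_pos hm' hc)
  simp only [Finset.sum_apply, integral_sum_infinitePi μ (hf2.integrable one_le_two),
    variance_sum_infinitePi μ hf hf2] at chebyshev
  have event (ω : ℕ → Ω) : c ≤ |(∑ i ∈ Finset.range m, f (ω i)) / m - ∫ x, f x ∂μ| ↔
      m * c ≤ |∑ i ∈ Finset.range m, f (ω i) - m * ∫ x, f x ∂μ| := by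
    rw [← mul_le_mul_iff_right₀ hm']
    nth_rw 2 [← abs_of_pos hm']
    rw [← abs_mul, mul_sub, mul_div_cancel₀ _ hm'.ne']
  simp only [event]
  refine (ENNReal.toReal_le_of_le_ofReal
    (div_nonneg (mul_nonneg hm'.le (variance_nonneg f μ)) (sq_nonneg _)) chebyshev).trans_eq ?_
  field_simp

end Chebyshev

/- It suffices to control `F` at both ends of every level set of `⌊G⌋₊`. -/
theorem exists_finset_abs_sub_le {G : ℕ → ℝ} (hG : Monotone G) (hG0 : ∀ x, 0 ≤ G x) {N n : ℕ}
    (hGN : ∀ x, G x ≤ N) (hn : G n = N) :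
    ∃ S : Finset ℕ, S.card ≤ 2 * N ∧ ∀ F : ℕ → ℝ, Monotone F → (∀ x, 0 ≤ F x) →
      (∀ x, F x ≤ N) → (∀ x ∈ S, |F x - G x| ≤ 1) → ∀ x, |F x - G x| ≤ 2 := by
  let block (i : ℕ) : Set ℕ := {x | ⌊G x⌋₊ = i}
  have le_of_mem {i x : ℕ} (hx : x ∈ block i) : i ≤ G x :=
    (show ⌊G x⌋₊ = i from hx) ▸ Nat.floor_le (hG0 x)
  have lt_of_mem {i x : ℕ} (hx : x ∈ block i) : G x < i + 1 :=
    (show ⌊G x⌋₊ = i from hx) ▸ Nat.lt_floor_add_one (G x)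
  have bddAbove {i : ℕ} (hi : i < N) : BddAbove (block i) := by
    refine ⟨n, fun x hx => le_of_not_gt fun hnx => (lt_of_mem hx).not_ge ?_⟩
    exact le_trans (mod_cast hi) (hn.ge.trans (hG hnx.le))
  let S := (Finset.range N).image (fun i => sSup (block i)) ∪
    (Finset.range N).image fun i => sInf (block (i + 1))
  have card_S : S.card ≤ 2 * N := by
    refine (Finset.card_union_le _ _).trans ?_
    rw [two_mul]
    exact add_le_add (Finset.card_image_le.trans_eq (Finset.card_range N))
      (Finset.card_image_le.trans_eq (Finset.card_range N))
  refine ⟨S, card_S, fun F hF hF0 hFN hFS x => abs_le.2 ?_⟩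
  obtain ⟨i, hi⟩ : ∃ i, x ∈ block i := ⟨_, rfl⟩
  have hiN : i ≤ N := Nat.cast_le.1 ((le_of_mem hi).trans (hGN x))
  constructor
  · rcases i with - | i
    · have hx := lt_of_mem hi
      rw [Nat.cast_zero] at hx
      linarith [hF0 x]
    · have hmem := Nat.sInf_mem ⟨x, hi⟩
      have hS := hFS (sInf (block (i + 1))) (Finset.mem_union_right _
        (Finset.mem_image_of_mem _ (Finset.mem_range.2 hiN)))
      linarith [hF (Nat.sInf_le hi), (abs_le.1 hS).1, le_of_mem hmem, lt_of_mem hi]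
  · rcases hiN.eq_or_lt with rfl | hiN
    · linarith [le_of_mem hi, hFN x]
    · have hmem := Nat.sSup_mem ⟨x, hi⟩ (bddAbove hiN)
      have hS := hFS (sSup (block i)) (Finset.mem_union_left _
        (Finset.mem_image_of_mem _ (Finset.mem_range.2 hiN)))
      linarith [hF (le_csSup (bddAbove hiN) hi), (abs_le.1 hS).2, le_of_mem hi, lt_of_mem hmem]

section Uniform

variable (μ : Measure ℕ) [IsProbabilityMeasure μ]

theorem infinitePi_real_le_abs_empiricalCDF_sub (x : ℕ) {m : ℕ} (hm : 0 < m) {c : ℝ}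
    (hc : 0 < c) :
    (Measure.infinitePi fun _ : ℕ => μ).real
      {ω | c ≤ |empiricalCDF ω m x - μ.real (Set.Iio x)|} ≤ 1 / (4 * m * c ^ 2) := by
  have bounded : ∀ᵐ j ∂μ, (Set.Iio x).indicator (1 : ℕ → ℝ) j ∈ Set.Icc 0 1 :=
    .of_forall fun j => by rw [Set.indicator_apply]; split_ifs <;> simp
  have measurable : Measurable ((Set.Iio x).indicator (1 : ℕ → ℝ)) := measurable_of_countable _
  have variance_le := variance_le_sq_of_bounded bounded measurable.aemeasurable
  simp only [empiricalCDF_eq_sum, ← integral_indicator_one (μ := μ) (measurableSet_Iio (a := x))]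
  refine (infinitePi_real_le_abs_average_sub μ measurable
    (memLp_of_bounded bounded measurable.aestronglyMeasurable 2) hm hc).trans ?_
  calc _ ≤ ((1 - 0) / 2) ^ 2 / (m * c ^ 2) := by gcongr
    _ = 1 / (4 * m * c ^ 2) := by field_simp; norm_num

theorem real_Iio_succ_eq_one {n : ℕ} (hμ : ∀ᵐ j ∂μ, j ≤ n) : μ.real (Set.Iio (n + 1)) = 1 := by
  rw [measureReal_def, (mem_ae_iff_prob_eq_one measurableSet_Iio).1, ENNReal.toReal_one]
  exact hμ.mono fun _ => Nat.lt_succ_of_le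

theorem infinitePi_real_exists_lt_abs_empiricalCDF_sub {n : ℕ} (hμ : ∀ᵐ j ∂μ, j ≤ n) {N m : ℕ}
    (hN : 0 < N) (hm : 0 < m) :
    (Measure.infinitePi fun _ : ℕ => μ).real
      {ω | ∃ x, 2 / N < |empiricalCDF ω m x - μ.real (Set.Iio x)|} ≤ N ^ 3 / (2 * m) := by
  have hN' : (0 : ℝ) < N := Nat.cast_pos.2 hN
  have mul_le {t : ℝ} (ht : t ≤ 1) : N * t ≤ N := mul_le_of_le_one_right hN'.le ht
  obtain ⟨S, card_S, hS⟩ := exists_finset_abs_sub_le (G := fun x => N * μ.real (Set.Iio x))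
    (fun a b hab => mul_le_mul_of_nonneg_left (measureReal_mono (Set.Iio_subset_Iio hab)) hN'.le)
    (fun x => by positivity) (fun x => mul_le measureReal_le_one)
    (by rw [real_Iio_succ_eq_one μ hμ, mul_one])
  have abs_mul_sub (s t : ℝ) : |N * s - N * t| = N * |s - t| := by
    rw [← mul_sub, abs_mul, abs_of_pos hN']
  have cover : {ω : ℕ → ℕ | ∃ x, 2 / N < |empiricalCDF ω m x - μ.real (Set.Iio x)|} ⊆
      ⋃ x ∈ S, {ω | 1 / N ≤ |empiricalCDF ω m x - μ.real (Set.Iio x)|} := by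
    rintro ω ⟨x, hx⟩
    by_contra h
    simp only [Set.mem_iUnion, Set.mem_ofPred_eq, not_exists, not_le] at h
    refine hx.not_ge ?_
    have := hS (fun x => N * empiricalCDF ω m x)
      ((empiricalCDF_mono ω m).const_mul hN'.le)
      (fun x => mul_nonneg hN'.le (empiricalCDF_nonneg ω m x))
      (fun x => mul_le (empiricalCDF_le_one ω m x))
      (fun x hx => by rw [abs_mul_sub, ← le_div_iff₀' hN']; exact (h x hx).le) x
    rwa [le_div_iff₀' hN', ← abs_mul_sub]
  calc _ ≤ ∑ x ∈ S, (Measure.infinitePi fun _ : ℕ => μ).real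
        {ω | 1 / N ≤ |empiricalCDF ω m x - μ.real (Set.Iio x)|} :=
        (measureReal_mono cover (measure_ne_top _ _)).trans (measureReal_biUnion_finset_le _ _)
    _ ≤ ∑ _x ∈ S, (N ^ 2 / (4 * m) : ℝ) := Finset.sum_le_sum fun x _ =>
        (infinitePi_real_le_abs_empiricalCDF_sub μ x hm (by positivity)).trans_eq
          (by field_simp)
    _ ≤ (2 * N : ℕ) * (N ^ 2 / (4 * m) : ℝ) := by
        rw [Finset.sum_const, nsmul_eq_mul]
        gcongr
    _ = N ^ 3 / (2 * m) := by push_cast; field_simp; norm_num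

end Uniform

/-! ### Flattening a log-concave distribution -/

section Average

variable {ι : Type*} {s : Finset ι} {f : ι → ℝ}

theorem sum_abs_sub_average_le (hf : ∀ i ∈ s, 0 ≤ f i) :
    ∑ j ∈ s, |f j - (∑ i ∈ s, f i) / s.card| ≤ ∑ j ∈ s, 2 * f j := by
  rcases s.eq_empty_or_nonempty with rfl | hs
  · rfl
  have card_pos : (0 : ℝ) < s.card := Nat.cast_pos.2 hs.card_pos
  have average_nonneg : 0 ≤ (∑ i ∈ s, f i) / s.card :=
    div_nonneg (Finset.sum_nonneg hf) card_pos.le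
  calc ∑ j ∈ s, |f j - (∑ i ∈ s, f i) / s.card|
      ≤ ∑ j ∈ s, (f j + (∑ i ∈ s, f i) / s.card) := Finset.sum_le_sum fun j hj =>
        abs_le.2 ⟨by linarith [hf j hj], by linarith⟩
    _ = ∑ j ∈ s, 2 * f j := by
        rw [Finset.sum_add_distrib, Finset.sum_const, nsmul_eq_mul,
          mul_div_cancel₀ _ card_pos.ne', ← two_mul, Finset.mul_sum]

theorem sum_abs_sub_average_le_mul {ρ : ℝ} (hf : ∀ i ∈ s, ∀ j ∈ s, f i ≤ (1 + ρ) * f j) :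
    ∑ j ∈ s, |f j - (∑ i ∈ s, f i) / s.card| ≤ ∑ j ∈ s, 2 * ρ * f j := by
  rcases s.eq_empty_or_nonempty with rfl | hs
  · rfl
  have card_pos : (0 : ℝ) < s.card := Nat.cast_pos.2 hs.card_pos
  have sum_average : ∑ _j ∈ s, (∑ i ∈ s, f i) / s.card = ∑ i ∈ s, f i := by
    rw [Finset.sum_const, nsmul_eq_mul, mul_div_cancel₀ _ card_pos.ne']
  have average_le (j : ι) (hj : j ∈ s) : (∑ i ∈ s, f i) / s.card ≤ (1 + ρ) * f j := by
    rw [div_le_iff₀' card_pos, ← nsmul_eq_mul]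
    exact Finset.sum_le_card_nsmul _ _ _ fun i hi => hf i hi j hj
  have le_average (j : ι) (hj : j ∈ s) : f j ≤ (1 + ρ) * ((∑ i ∈ s, f i) / s.card) := by
    rw [← mul_div_assoc, le_div_iff₀' card_pos, ← nsmul_eq_mul, Finset.mul_sum]
    exact Finset.card_nsmul_le_sum _ _ _ fun i hi => hf j hj i hi
  have rel_nonneg (j : ι) (hj : j ∈ s) : 0 ≤ ρ * f j := by linarith [hf j hj j hj]
  have rel_average_nonneg : 0 ≤ ρ * ((∑ i ∈ s, f i) / s.card) := by
    rw [← mul_div_assoc, Finset.mul_sum]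
    exact div_nonneg (Finset.sum_nonneg rel_nonneg) card_pos.le
  calc ∑ j ∈ s, |f j - (∑ i ∈ s, f i) / s.card|
      ≤ ∑ j ∈ s, ρ * (f j + (∑ i ∈ s, f i) / s.card) := Finset.sum_le_sum fun j hj =>
        abs_le.2 ⟨by linarith [average_le j hj], by linarith [le_average j hj, rel_nonneg j hj]⟩
    _ = ∑ j ∈ s, 2 * ρ * f j := by
        rw [← Finset.mul_sum, Finset.sum_add_distrib, sum_average, ← Finset.mul_sum]
        ring

theorem sum_abs_sub_div_card_le (m c : ℝ) :
    ∑ j ∈ s, |f j - c / s.card| ≤ ∑ j ∈ s, |f j - m / s.card| + |m - c| := by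
  rcases s.eq_empty_or_nonempty with rfl | hs
  · exact (abs_nonneg _).trans (le_add_of_nonneg_left le_rfl)
  have card_pos : (0 : ℝ) < s.card := Nat.cast_pos.2 hs.card_pos
  calc ∑ j ∈ s, |f j - c / s.card|
      ≤ ∑ j ∈ s, (|f j - m / s.card| + |m - c| / s.card) := Finset.sum_le_sum fun j _ => by
        refine (abs_sub_le _ (m / s.card) _).trans_eq ?_
        rw [← sub_div, abs_div, abs_of_pos card_pos]
    _ = ∑ j ∈ s, |f j - m / s.card| + |m - c| := by
        rw [Finset.sum_add_distrib, Finset.sum_const, nsmul_eq_mul, mul_div_cancel₀ _ card_pos.ne']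

end Average

theorem sum_Ico_le_sum_Ico {f : ℕ → ℝ} (hf : ∀ j, 0 ≤ f j) {a b c d : ℕ} (hca : c ≤ a)
    (hbd : b ≤ d) : ∑ k ∈ Finset.Ico a b, f k ≤ ∑ k ∈ Finset.Ico c d, f k :=
  Finset.sum_le_sum_of_subset_of_nonneg (Finset.Ico_subset_Ico hca hbd) fun k _ _ => hf k

theorem le_one_add_div_mul {x y T τ δ : ℝ} (hτ : 0 < τ) (hT : τ ≤ T) (hδ : 0 ≤ δ) (hy : 0 ≤ y)
    (h : x * T ≤ y * (T + δ)) : x ≤ (1 + δ / τ) * y := by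
  have hT0 : 0 < T := hτ.trans_le hT
  calc x ≤ y * (T + δ) / T := (le_div_iff₀ hT0).2 h
    _ = (1 + δ / T) * y := by field_simp
    _ ≤ (1 + δ / τ) * y := by gcongr

namespace LogConcave

variable {f : ℕ → ℝ} {n : ℕ} {τ δ : ℝ}

theorem mul_sum_Ico_le (hf : LogConcave f) {i j : ℕ} (hij : i ≤ j) (n : ℕ) :
    f i * ∑ k ∈ Finset.Ico j n, f k ≤ f j * ∑ k ∈ Finset.Ico i n, f k := by
  calc f i * ∑ k ∈ Finset.Ico j n, f k
      = ∑ k ∈ Finset.range (n - j), f i * f (j + k) := by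
        rw [Finset.sum_Ico_eq_sum_range, Finset.mul_sum]
    _ ≤ ∑ k ∈ Finset.range (n - j), f j * f (i + k) :=
        Finset.sum_le_sum fun k _ => hf.mul_le hij k.zero_le
    _ ≤ ∑ k ∈ Finset.range (n - i), f j * f (i + k) :=
        Finset.sum_le_sum_of_subset_of_nonneg (Finset.range_mono (Nat.sub_le_sub_left hij n))
          fun k _ _ => mul_nonneg (hf.nonneg _) (hf.nonneg _)
    _ = f j * ∑ k ∈ Finset.Ico i n, f k := by
        rw [Finset.sum_Ico_eq_sum_range, Finset.mul_sum]

theorem mul_sum_range_le (hf : LogConcave f) {i j : ℕ} (hij : i ≤ j) :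
    f j * ∑ k ∈ Finset.range (i + 1), f k ≤ f i * ∑ k ∈ Finset.range (j + 1), f k := by
  calc f j * ∑ k ∈ Finset.range (i + 1), f k
      = ∑ k ∈ Finset.range (i + 1), f k * f (i + (j - i)) := by
        rw [Finset.mul_sum, Nat.add_sub_cancel' hij]
        exact Finset.sum_congr rfl fun _ _ => mul_comm _ _
    _ ≤ ∑ k ∈ Finset.range (i + 1), f i * f (j - i + k) := Finset.sum_le_sum fun k hk => by
        rw [add_comm (j - i)]
        exact hf.mul_le (Finset.mem_range_succ_iff.1 hk) (j - i).zero_le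
    _ = f i * ∑ k ∈ Finset.Ico (j - i) (j + 1), f k := by
        rw [Finset.sum_Ico_eq_sum_range, Finset.mul_sum, show j + 1 - (j - i) = i + 1 by omega]
    _ ≤ f i * ∑ k ∈ Finset.range (j + 1), f k := by
        rw [Finset.range_eq_Ico]
        exact mul_le_mul_of_nonneg_left (sum_Ico_le_sum_Ico hf.nonneg (j - i).zero_le le_rfl)
          (hf.nonneg i)

theorem le_mul_of_mem_Ico (hf : LogConcave f) (hτ : 0 < τ) {a b : ℕ} (hb : b ≤ n)
    (hmass : ∑ k ∈ Finset.Ico a b, f k ≤ δ) (hhead : τ ≤ ∑ k ∈ Finset.range (a + 1), f k)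
    (htail : τ ≤ ∑ k ∈ Finset.Ico (b - 1) n, f k) {i j : ℕ} (hi : i ∈ Finset.Ico a b)
    (hj : j ∈ Finset.Ico a b) : f i ≤ (1 + δ / τ) * f j := by
  rw [Finset.mem_Ico] at hi hj
  have hδ : 0 ≤ δ := (Finset.sum_nonneg fun k _ => hf.nonneg k).trans hmass
  have mass_le {c d : ℕ} (hc : a ≤ c) (hd : d ≤ b) : ∑ k ∈ Finset.Ico c d, f k ≤ δ :=
    (sum_Ico_le_sum_Ico hf.nonneg hc hd).trans hmass
  rcases le_total i j with hij | hij
  · refine le_one_add_div_mul hτ (htail.trans (sum_Ico_le_sum_Ico hf.nonneg (a := b - 1)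
      (c := j) (by omega) le_rfl)) hδ (hf.nonneg j) ((hf.mul_sum_Ico_le hij n).trans ?_)
    rw [← Finset.sum_Ico_consecutive f hij (by omega : j ≤ n), add_comm]
    exact mul_le_mul_of_nonneg_left (add_le_add_right (mass_le hi.1 hj.2.le) _) (hf.nonneg j)
  · rw [Finset.range_eq_Ico] at hhead
    refine le_one_add_div_mul hτ (hhead.trans (sum_Ico_le_sum_Ico hf.nonneg le_rfl (b := a + 1)
      (d := j + 1) (by omega))) hδ (hf.nonneg j) ?_
    rw [← Finset.range_eq_Ico]
    refine (hf.mul_sum_range_le hij).trans ?_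
    rw [← Finset.sum_range_add_sum_Ico f (by omega : j + 1 ≤ i + 1)]
    exact mul_le_mul_of_nonneg_left (add_le_add_right (mass_le (by omega) hi.2) _) (hf.nonneg j)

end LogConcave

section flatteningError

variable {f : ℕ → ℝ} {n a b : ℕ} {ρ θ τ δ : ℝ}

open Classical in
/-- A bound for the error at `j` of replacing `f` by its average on an interval around `j`. It
consists of a relative error `ρ` and, at the points cutting off a head or a tail of mass at most
`θ`, of the crude bound `f j`. -/
noncomputable def flatteningError (f : ℕ → ℝ) (n : ℕ) (ρ θ : ℝ) (j : ℕ) : ℝ :=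
  2 * ρ * f j + (if ∑ k ∈ Finset.range (j + 1), f k ≤ θ then 2 * f j else 0) +
    if ∑ k ∈ Finset.Ico j n, f k ≤ θ then 2 * f j else 0

theorem mul_le_flatteningError (hf : ∀ j, 0 ≤ f j) (j : ℕ) :
    2 * ρ * f j ≤ flatteningError f n ρ θ j := by
  have := hf j
  rw [flatteningError]
  split_ifs <;> linarith

theorem two_mul_le_flatteningError (hf : ∀ j, 0 ≤ f j) (hρ : 0 ≤ ρ) {j : ℕ}
    (hj : ∑ k ∈ Finset.range (j + 1), f k ≤ θ ∨ ∑ k ∈ Finset.Ico j n, f k ≤ θ) :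
    2 * f j ≤ flatteningError f n ρ θ j := by
  have := hf j
  have := mul_nonneg hρ this
  rw [flatteningError]
  rcases hj with hj | hj <;> rw [if_pos hj] <;> split_ifs <;> linarith

theorem flatteningError_nonneg (hf : ∀ j, 0 ≤ f j) (hρ : 0 ≤ ρ) (j : ℕ) :
    0 ≤ flatteningError f n ρ θ j :=
  (mul_nonneg (mul_nonneg zero_le_two hρ) (hf j)).trans (mul_le_flatteningError hf j)

theorem sum_filter_head_le (hf : ∀ j, 0 ≤ f j) (hθ : 0 ≤ θ) (s : Finset ℕ) :
    ∑ j ∈ s with ∑ k ∈ Finset.range (j + 1), f k ≤ θ, f j ≤ θ := by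
  set t := {j ∈ s | ∑ k ∈ Finset.range (j + 1), f k ≤ θ}
  rcases t.eq_empty_or_nonempty with ht | ht
  · rwa [ht]
  · refine le_trans ?_ (Finset.mem_filter.1 (t.max'_mem ht)).2
    exact Finset.sum_le_sum_of_subset_of_nonneg
      (fun j hj => Finset.mem_range_succ_iff.2 (t.le_max' j hj)) fun j _ _ => hf j

theorem sum_filter_tail_le (hf : ∀ j, 0 ≤ f j) (hθ : 0 ≤ θ) (n : ℕ) :
    ∑ j ∈ Finset.range n with ∑ k ∈ Finset.Ico j n, f k ≤ θ, f j ≤ θ := by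
  set t := {j ∈ Finset.range n | ∑ k ∈ Finset.Ico j n, f k ≤ θ}
  rcases t.eq_empty_or_nonempty with ht | ht
  · rwa [ht]
  · refine le_trans ?_ (Finset.mem_filter.1 (t.min'_mem ht)).2
    exact Finset.sum_le_sum_of_subset_of_nonneg (fun j hj => Finset.mem_Ico.2
      ⟨t.min'_le j hj, Finset.mem_range.1 (Finset.mem_filter.1 hj).1⟩) fun j _ _ => hf j

theorem sum_flatteningError_le (hf : ∀ j, 0 ≤ f j) (hθ : 0 ≤ θ) (n : ℕ) :
    ∑ j ∈ Finset.range n, flatteningError f n ρ θ j ≤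
      2 * ρ * ∑ j ∈ Finset.range n, f j + 4 * θ := by
  have head := sum_filter_head_le hf hθ (Finset.range n)
  have tail := sum_filter_tail_le hf hθ n
  simp only [flatteningError, Finset.sum_add_distrib, ← Finset.sum_filter, ← Finset.mul_sum]
  linarith

theorem LogConcave.sum_abs_sub_average_Ico_le (hf : LogConcave f) (hτ : 0 < τ) (hb : b ≤ n)
    (hmass : ∑ k ∈ Finset.Ico a b, f k ≤ δ) :
    ∑ j ∈ Finset.Ico a b, |f j - (∑ k ∈ Finset.Ico a b, f k) / (Finset.Ico a b).card| ≤
      ∑ j ∈ Finset.Ico a b, flatteningError f n (δ / τ) (τ + δ) j := by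
  have hδ : 0 ≤ δ / τ :=
    div_nonneg ((Finset.sum_nonneg fun k _ => hf.nonneg k).trans hmass) hτ.le
  rcases le_or_gt b a with hba | hab
  · rw [Finset.Ico_eq_empty_of_le hba, Finset.sum_empty, Finset.sum_empty]
  by_cases hhead : τ ≤ ∑ k ∈ Finset.range (a + 1), f k
  · by_cases htail : τ ≤ ∑ k ∈ Finset.Ico (b - 1) n, f k
    · exact (sum_abs_sub_average_le_mul fun i hi j hj =>
        hf.le_mul_of_mem_Ico hτ hb hmass hhead htail hi hj).trans
          (Finset.sum_le_sum fun j _ => mul_le_flatteningError hf.nonneg j)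
    · refine (sum_abs_sub_average_le fun j _ => hf.nonneg j).trans (Finset.sum_le_sum fun j hj =>
        two_mul_le_flatteningError hf.nonneg hδ (.inr ?_))
      calc ∑ k ∈ Finset.Ico j n, f k
          ≤ ∑ k ∈ Finset.Ico a n, f k :=
            sum_Ico_le_sum_Ico hf.nonneg (Finset.mem_Ico.1 hj).1 le_rfl
        _ = ∑ k ∈ Finset.Ico b n, f k + ∑ k ∈ Finset.Ico a b, f k := by
            rw [add_comm, Finset.sum_Ico_consecutive f hab.le hb]
        _ ≤ τ + δ := add_le_add ((sum_Ico_le_sum_Ico hf.nonneg b.pred_le le_rfl).trans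
            (not_le.1 htail).le) hmass
  · refine (sum_abs_sub_average_le fun j _ => hf.nonneg j).trans (Finset.sum_le_sum fun j hj =>
      two_mul_le_flatteningError hf.nonneg hδ (.inl ?_))
    calc ∑ k ∈ Finset.range (j + 1), f k
        ≤ ∑ k ∈ Finset.range b, f k := by
          rw [Finset.range_eq_Ico, Finset.range_eq_Ico]
          exact sum_Ico_le_sum_Ico hf.nonneg le_rfl (Finset.mem_Ico.1 hj).2
      _ = ∑ k ∈ Finset.range a, f k + ∑ k ∈ Finset.Ico a b, f k :=
          (Finset.sum_range_add_sum_Ico f hab.le).symm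
      _ ≤ τ + δ := add_le_add ((Finset.sum_range_succ f a ▸ le_add_of_nonneg_right
          (hf.nonneg a)).trans (not_le.1 hhead).le) hmass

end flatteningError

/-! ### The error of the learned histogram -/

section binError

variable {f : ℕ → ℝ} {y : ℕ → ℕ} {K M R n a b r : ℕ} {τ δ η : ℝ}

theorem abs_sampleCount_div_sub_sum_le
    (hη : ∀ x, |empiricalCDF y M x - ∑ k ∈ Finset.range x, f k| ≤ η) (hab : a ≤ b) :
    |(sampleCount y M a b : ℝ) / M - ∑ k ∈ Finset.Ico a b, f k| ≤ 2 * η := by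
  rw [← empiricalCDF_sub y M hab, Finset.sum_Ico_eq_sub _ hab, sub_sub_sub_comm, two_mul]
  exact (abs_sub _ _).trans (add_le_add (hη b) (hη a))

theorem abs_sampleCount_div_sub_binWeight_div_le (y : ℕ → ℕ) (hM : 0 < M) (hR : 0 < R)
    (hab : a < b) :
    |(sampleCount y M a b : ℝ) / M - (binWeight y M R a b : ℝ) / R| ≤ ((b : ℝ) - a) / R := by
  have hM' : (0 : ℝ) < M := Nat.cast_pos.2 hM
  have hR' : (0 : ℝ) < R := Nat.cast_pos.2 hR
  have lower : (M : ℝ) * binWeight y M R a b ≤ sampleCount y M a b * R := mod_cast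
    mul_binWeight_le y M R a b
  have upper : (sampleCount y M a b : ℝ) * R ≤ M * binWeight y M R a b + M * ((b : ℝ) - a) := by
    rw [← Nat.cast_sub hab.le]
    norm_cast
    rw [binWeight, ← mul_assoc, ← Nat.mul_succ]
    exact (Nat.lt_mul_div_succ _ (Nat.mul_pos hM (Nat.sub_pos_of_lt hab))).le
  rw [div_sub_div _ _ hM'.ne' hR'.ne', abs_of_nonneg (div_nonneg (by linarith) (by positivity)),
    div_le_div_iff₀ (by positivity) hR']
  nlinarith

theorem sampleCount_nextBreakpoint_eq_zero (ha : a < n) (hne : nextBreakpoint y K n a ≠ a + 1) :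
    sampleCount y K a (nextBreakpoint y K n a) = 0 := by
  have hb := isLeast_nextBreakpoint y K ha
  have := lt_nextBreakpoint y K ha
  rw [sampleCount, Finset.card_eq_zero, Finset.filter_eq_empty_iff]
  rintro i hi ⟨hay, hyb⟩
  rw [Finset.mem_range] at hi
  rcases hay.eq_or_lt with h | h
  · have := hb.2 ⟨by omega, .inr ⟨i, hi, .inr rfl⟩⟩
    omega
  · exact hyb.not_ge (hb.2 ⟨h, .inr ⟨i, hi, .inl rfl⟩⟩)

theorem LogConcave.sum_abs_sub_average_nextBreakpoint_le (hf : LogConcave f) (hτ : 0 < τ)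
    (hδ : ∀ x, |empiricalCDF y K x - ∑ k ∈ Finset.range x, f k| ≤ δ / 2) (ha : a < n) :
    ∑ j ∈ Finset.Ico a (nextBreakpoint y K n a),
        |f j - (∑ k ∈ Finset.Ico a (nextBreakpoint y K n a), f k) /
          (Finset.Ico a (nextBreakpoint y K n a)).card| ≤
      ∑ j ∈ Finset.Ico a (nextBreakpoint y K n a),
        flatteningError f (n + 1) (δ / τ) (τ + δ) j := by
  by_cases hne : nextBreakpoint y K n a = a + 1
  · have hδ0 : 0 ≤ δ := by linarith [(abs_nonneg _).trans (hδ 0)]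
    rw [hne, Nat.Ico_succ_singleton, Finset.card_singleton, Nat.cast_one, div_one,
      Finset.sum_singleton, Finset.sum_singleton, sub_self, abs_zero, Finset.sum_singleton]
    exact flatteningError_nonneg hf.nonneg (div_nonneg hδ0 hτ.le) a
  · refine hf.sum_abs_sub_average_Ico_le hτ ((nextBreakpoint_le y K ha).trans n.le_succ) ?_
    have := abs_sampleCount_div_sub_sum_le hδ (lt_nextBreakpoint y K ha).le
    rw [sampleCount_nextBreakpoint_eq_zero ha hne, Nat.cast_zero, zero_div, zero_sub, abs_neg]
      at this
    linarith [le_abs_self (∑ k ∈ Finset.Ico a (nextBreakpoint y K n a), f k)]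

theorem Histogram.sum_abs_sub_pointWeight_cons (f : ℕ → ℝ) {N : ℕ} (x : ℝ) (w : ℕ)
    (bs : List (ℕ × ℕ)) (hab : a ≤ b) (hbN : b ≤ N) :
    ∑ j ∈ Finset.Ico a N, |f j - pointWeight ((b - a, w) :: bs) (j - a) / x| =
      ∑ j ∈ Finset.Ico a b, |f j - w / x / (Finset.Ico a b).card| +
        ∑ j ∈ Finset.Ico b N, |f j - pointWeight bs (j - b) / x| := by
  rw [← Finset.sum_Ico_consecutive _ hab hbN]
  congr 1 <;> refine Finset.sum_congr rfl fun j hj => ?_ <;> rw [Finset.mem_Ico] at hj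
  · rw [pointWeight, if_pos (by omega), Nat.card_Ico, div_right_comm]
  · rw [pointWeight, if_neg (by omega), show j - a - (b - a) = j - b by omega]

theorem abs_sum_Ico_sub_binWeight_div_le (hM : 0 < M) (hR : 0 < R)
    (hη : ∀ x, |empiricalCDF y M x - ∑ k ∈ Finset.range x, f k| ≤ η) (hab : a < b) :
    |∑ k ∈ Finset.Ico a b, f k - (binWeight y M R a b : ℝ) / R| ≤
      2 * η + ((b : ℝ) - a) / R := by
  refine (abs_sub_le _ ((sampleCount y M a b : ℝ) / M) _).trans (add_le_add ?_
    (abs_sampleCount_div_sub_binWeight_div_le y hM hR hab))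
  rw [abs_sub_comm]
  exact abs_sampleCount_div_sub_sum_le hη hab.le

/-- Each bin contributes its flattening error and the error of its weight. The latter also changes
the mass left for the following bins, hence the factor `2`. -/
theorem LogConcave.sum_abs_sub_pointWeight_bins_le (hf : LogConcave f) (hτ : 0 < τ) (hM : 0 < M)
    (hR : 0 < R) (hδ : ∀ x, |empiricalCDF y K x - ∑ k ∈ Finset.range x, f k| ≤ δ / 2)
    (hη : ∀ x, |empiricalCDF y M x - ∑ k ∈ Finset.range x, f k| ≤ η) (ha : a ≤ n)
    (hr : sampleCount y M a n * R ≤ M * r) :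
    ∑ j ∈ Finset.Ico a (n + 1), |f j - Histogram.pointWeight (bins y K M R n a r) (j - a) / R| ≤
      ∑ j ∈ Finset.Ico a (n + 1), flatteningError f (n + 1) (δ / τ) (τ + δ) j +
        2 * (((bins y K M R n a r).length - 1) * (2 * η) + ((n : ℝ) - a) / R) +
        |∑ k ∈ Finset.Ico a (n + 1), f k - r / R| := by
  fun_induction bins with
  | case1 a r hlt ih =>
    have hab := lt_nextBreakpoint y K hlt
    have hbn := nextBreakpoint_le y K hlt
    have flattening := hf.sum_abs_sub_average_nextBreakpoint_le hτ hδ hlt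
    have weight_error := abs_sum_Ico_sub_binWeight_div_le hM hR hη hab
    generalize nextBreakpoint y K n a = b at *
    obtain ⟨hw, hr'⟩ := binWeight_le hM hab.le hbn hr
    generalize binWeight y M R a b = w at *
    have remaining : |∑ k ∈ Finset.Ico b (n + 1), f k - ((r - w : ℕ) : ℝ) / R| ≤
        |∑ k ∈ Finset.Ico a (n + 1), f k - r / R| + |∑ k ∈ Finset.Ico a b, f k - w / R| := by
      rw [← Finset.sum_Ico_consecutive f hab.le (hbn.trans n.le_succ), Nat.cast_sub hw, sub_div]
      refine le_trans (le_of_eq ?_) (abs_sub _ _)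
      congr 1
      ring
    have replaced := sum_abs_sub_div_card_le (s := Finset.Ico a b) (f := f)
      (∑ k ∈ Finset.Ico a b, f k) (w / R)
    have hlen : ((n : ℝ) - a) / R = ((n : ℝ) - b) / R + ((b : ℝ) - a) / R := by ring
    rw [Histogram.sum_abs_sub_pointWeight_cons f R w _ hab.le (hbn.trans n.le_succ),
      ← Finset.sum_Ico_consecutive (flatteningError _ _ _ _) hab.le (hbn.trans n.le_succ), hlen,
      List.length_cons, Nat.cast_add_one]
    linarith [ih hbn hr']
  | case2 a r hlt =>
    obtain rfl : a = n := by omega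
    have hδ0 : 0 ≤ δ := by linarith [(abs_nonneg _).trans (hδ 0)]
    have := flatteningError_nonneg (n := a + 1) (θ := τ + δ) hf.nonneg (div_nonneg hδ0 hτ.le) a
    simpa [Histogram.pointWeight] using this

end binError

namespace Learner

section Accuracy

variable {μ : Measure ℕ} [IsProbabilityMeasure μ] {y : ℕ → ℕ} {n E : ℕ}

theorem sum_abs_sub_prob_hypothesis_le {f : ℕ → ℝ} {τ δ η : ℝ} (hf : LogConcave f)
    (hsum : ∑ k ∈ Finset.range (n + 1), f k = 1) (hE : 0 < E) (hτ : 0 < τ)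
    (hδ : ∀ x, |empiricalCDF y (firstCount E) x - ∑ k ∈ Finset.range x, f k| ≤ δ / 2)
    (hη : ∀ x, |empiricalCDF y (secondCount E) x - ∑ k ∈ Finset.range x, f k| ≤ η) :
    ∑ j ∈ Finset.range (n + 1), |f j - (hypothesis y n E).prob j| ≤
      2 * (δ / τ) + 4 * (τ + δ) +
        2 * ((2 * firstCount E + 1) * (2 * η) + n / (2 : ℝ) ^ weightLog n E) := by
  have hδ0 : 0 ≤ δ := by linarith [(abs_nonneg _).trans (hδ 0)]
  have hη0 : 0 ≤ η := (abs_nonneg _).trans (hη 0)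
  have hM : 0 < secondCount E := by have := forty_le_secondCount hE; omega
  have hlen : ((hypothesis y n E).bins.length : ℝ) ≤ 2 * firstCount E + 2 := mod_cast length_bins_le
  have flattening := sum_flatteningError_le (ρ := δ / τ) hf.nonneg (add_nonneg hτ.le hδ0) (n + 1)
  have binwise := hf.sum_abs_sub_pointWeight_bins_le hτ hM (Nat.two_pow_pos (weightLog n E)) hδ hη
    n.zero_le (Nat.mul_le_mul_right _ (sampleCount_le y (secondCount E) 0 n))
  rw [hsum] at flattening
  simp only [← Finset.range_eq_Ico, hsum, Nat.sub_zero, Nat.cast_zero, sub_zero, Nat.cast_pow,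
    Nat.cast_ofNat, div_self (pow_ne_zero (weightLog n E) (two_ne_zero (α := ℝ))), sub_self,
    abs_zero, add_zero] at binwise
  simp only [Histogram.prob, totalWeight_hypothesis y n hE, Nat.cast_pow, Nat.cast_ofNat]
  calc _ ≤ _ := binwise
    _ ≤ 2 * (δ / τ) * 1 + 4 * (τ + δ) +
        2 * ((2 * firstCount E + 1) * (2 * η) + n / (2 : ℝ) ^ weightLog n E) := by
      gcongr
      exact sub_le_iff_le_add.2 (hlen.trans_eq (by ring))
    _ = _ := by rw [mul_one]

theorem tvDist_hypothesis_le (hμ : ∀ᵐ j ∂μ, j ≤ n) (hlc : LogConcave fun j => μ.real {j})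
    (hE : 0 < E)
    (hK : ∀ x, |empiricalCDF y (firstCount E) x - μ.real (Set.Iio x)| ≤ 1 / firstScale E)
    (hM : ∀ x, |empiricalCDF y (secondCount E) x - μ.real (Set.Iio x)| ≤ 1 / secondScale E) :
    (hypothesis y n E).tvDist n μ ≤ 1 / E := by
  have hE' : (1 : ℝ) ≤ E := Nat.one_le_cast.2 hE
  have real_Iio (x : ℕ) : μ.real (Set.Iio x) = ∑ k ∈ Finset.range x, μ.real {k} := by
    rw [sum_measureReal_singleton, Finset.coe_range]
  have total := real_Iio_succ_eq_one μ hμ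
  simp only [real_Iio] at hK hM total
  have error := sum_abs_sub_prob_hypothesis_le (τ := 1 / (8 * E)) (δ := 1 / (64 * E ^ 2))
    hlc total hE (by positivity)
    (fun x => (hK x).trans_eq (by rw [firstScale]; push_cast; field_simp; norm_num)) hM
  have relative : 1 / (64 * (E : ℝ) ^ 2) / (1 / (8 * E)) = 1 / 8 * (1 / E) := by
    field_simp
    norm_num
  have cut : 1 / (64 * (E : ℝ) ^ 2) ≤ 1 / 64 * (1 / E) := by
    rw [← one_div_mul_one_div]
    gcongr
    exact le_self_pow₀ hE' two_ne_zero
  have weights : (2 * firstCount E + 1) * (2 * (1 / (secondScale E : ℝ))) = 1 / 4 * (1 / E) := by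
    rw [secondScale]
    push_cast
    field_simp
    norm_num
  have rounding : n / (2 : ℝ) ^ weightLog n E ≤ 1 / 4 * (1 / E) := by
    have : 4 * (n : ℝ) * E ≤ 2 ^ weightLog n E := mod_cast le_two_pow_weightLog n E
    rw [one_div_mul_one_div, div_le_div_iff₀ (by positivity) (by positivity)]
    linarith
  have : (0 : ℝ) < 1 / E := by positivity
  rw [Histogram.tvDist]
  rw [relative, weights, ← one_div_mul_one_div] at error
  linarith

theorem infinitePi_real_exists_lt_abs_empiricalCDF_sampleSize_sub {A : ℕ} (hμ : ∀ᵐ j ∂μ, j ≤ n)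
    (hA : 0 < A) :
    (Measure.infinitePi fun _ : ℕ => μ).real
      {ω | ∃ x, 1 / A < |empiricalCDF ω (sampleSize A) x - μ.real (Set.Iio x)|} ≤ 1 / 20 := by
  have bound := infinitePi_real_exists_lt_abs_empiricalCDF_sub μ hμ (N := 2 * A)
    (m := sampleSize A) (by omega) (hA.trans_le (le_sampleSize A))
  have precision : (2 : ℝ) / (2 * A : ℕ) = 1 / A := by push_cast; field_simp
  have failure : ((2 * A : ℕ) : ℝ) ^ 3 / (2 * sampleSize A) = 1 / 20 := by
    rw [sampleSize]
    push_cast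
    field_simp
    norm_num
  rwa [precision, failure] at bound

theorem infinitePi_ae_forall_le (hμ : ∀ᵐ j ∂μ, j ≤ n) :
    ∀ᵐ ω ∂Measure.infinitePi fun _ : ℕ => μ, ∀ i, ω i ≤ n :=
  ae_all_iff.2 fun i =>
    (measurePreserving_eval_infinitePi (fun _ : ℕ => μ) i).quasiMeasurePreserving.ae hμ

theorem infinitePi_real_tvDist_hypothesis_le (hμ : ∀ᵐ j ∂μ, j ≤ n)
    (hlc : LogConcave fun j => μ.real {j}) (hE : 0 < E) :
    9 / 10 ≤ (Measure.infinitePi fun _ : ℕ => μ).real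
      {ω | (∀ i, ω i ≤ n) ∧ (hypothesis ω n E).tvDist n μ ≤ 1 / E} := by
  set P := Measure.infinitePi fun _ : ℕ => μ
  let bad (A : ℕ) : Set (ℕ → ℕ) :=
    {ω | ∃ x, 1 / A < |empiricalCDF ω (sampleSize A) x - μ.real (Set.Iio x)|}
  let outOfRange : Set (ℕ → ℕ) := {ω | ¬∀ i, ω i ≤ n}
  have hscale : 0 < secondScale E := by have := firstCount_le_secondScale hE; omega
  have first : P.real (bad (firstScale E)) ≤ 1 / 20 :=
    infinitePi_real_exists_lt_abs_empiricalCDF_sampleSize_sub hμ (by rw [firstScale]; positivity)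
  have second : P.real (bad (secondScale E)) ≤ 1 / 20 :=
    infinitePi_real_exists_lt_abs_empiricalCDF_sampleSize_sub hμ hscale
  have null : P.real outOfRange = 0 := by
    rw [measureReal_def, ae_iff.1 (infinitePi_ae_forall_le hμ), ENNReal.toReal_zero]
  have cover : Set.univ ⊆ {ω | (∀ i, ω i ≤ n) ∧ (hypothesis ω n E).tvDist n μ ≤ 1 / E} ∪
      (bad (firstScale E) ∪ (bad (secondScale E) ∪ outOfRange)) := by
    intro ω _
    by_contra h
    simp only [Set.mem_union, not_or] at h
    obtain ⟨hgood, hfirst, hsecond, hrange⟩ := h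
    refine hgood ⟨not_not.1 hrange, tvDist_hypothesis_le hμ hlc hE (fun x => ?_) fun x => ?_⟩
    · exact not_lt.1 fun hx => hfirst ⟨x, hx⟩
    · exact not_lt.1 fun hx => hsecond ⟨x, hx⟩
  have total := (measureReal_mono (μ := P) cover).trans (measureReal_union_le _ _)
  rw [probReal_univ] at total
  have := measureReal_union_le (μ := P) (bad (firstScale E)) (bad (secondScale E) ∪ outOfRange)
  have := measureReal_union_le (μ := P) (bad (secondScale E)) outOfRange
  linarith

end Accuracy

end Learner

theorem theorem5_general :
    ∃ (learner sampler : Prog) (C : ℝ) (c : ℕ),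
      ∀ (n : ℕ) (ε : ℝ), 2 ≤ n → 0 < ε → ε ≤ 1 →
        (∀ ω : ℕ → ℕ, (∀ i, ω i ≤ n) →
          ∃ (s : MState) (H : Histogram),
            learner.Runs [n, ⌈1 / ε⌉₊] ω s ∧
            (s.drawn : ℝ) ≤ C * Real.log n * (1 / ε) ^ c ∧
            (s.bitOps : ℝ) ≤ C * Real.log n ^ 2 * (1 / ε) ^ c ∧
            s.out = H.encode ∧ H.IsOver n ∧
            (H.bins.length : ℝ) ≤ C * Real.log n * (1 / ε) ^ c ∧
            H.SampledBy n sampler (C * Real.log (n / ε)) (C * (Real.log n + 1 / ε) ^ c)) ∧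
        ∀ (μ : Measure ℕ) [IsProbabilityMeasure μ], (∀ᵐ j ∂μ, j ≤ n) →
          LogConcave (fun j => μ.real {j}) →
          9 / 10 ≤ (Measure.infinitePi fun _ : ℕ => μ).real
            {ω : ℕ → ℕ | ∃ (s : MState) (H : Histogram),
              learner.Runs [n, ⌈1 / ε⌉₊] ω s ∧ s.out = H.encode ∧ H.tvDist n μ ≤ ε} := by
  refine ⟨Learner.prog, Sampler.prog, 10 ^ 82, 44, fun n ε hn hε hε1 => ?_⟩
  have hn0 : 0 < n := two_pos.trans_le hn
  have hx : 1 ≤ 1 / ε := one_le_one_div hε hε1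
  have hE : 0 < ⌈1 / ε⌉₊ := Nat.ceil_pos.2 (one_pos.trans_le hx)
  refine ⟨fun ω hω => ?_, fun μ _ hμ hlc => ?_⟩
  · obtain ⟨s, hrun, hops, hout, hdrawn⟩ := Learner.exists_runs hn0 hE hω
    have hM := Learner.secondCount_le_log_mul hn hx
    have hlen := Learner.length_bins_hypothesis_le ω n hE
    exact ⟨s, Learner.hypothesis ω n ⌈1 / ε⌉₊, hrun, hdrawn ▸ hM,
      (Nat.cast_le.2 hops).trans (Learner.learner_cost_le hn hx), hout,
      Learner.hypothesis_isOver ω n hE, (Nat.cast_le.2 (by omega)).trans hM,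
      Learner.hypothesis_sampledBy ω hn0 hE
        (mul_one_div (n : ℝ) ε ▸ Learner.weightLog_ceil_le hn hx)
        (Learner.sampler_cost_le hn hx)⟩
  · have precision : (1 : ℝ) / ⌈1 / ε⌉₊ ≤ ε :=
      (one_div_le hε (Nat.cast_pos.2 hE)).1 (Nat.le_ceil _)
    refine (Learner.infinitePi_real_tvDist_hypothesis_le hμ hlc hE).trans
      (measureReal_mono fun ω ⟨hω, htv⟩ => ?_)
    obtain ⟨s, hrun, -, hout, -⟩ := Learner.exists_runs hn0 hE hω
    exact ⟨s, _, hrun, hout, htv.trans precision⟩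

theorem theorem5 :
    ∃ (learner sampler : Prog) (C : ℝ) (c : ℕ),
      ∀ (n : ℕ) (ε : ℝ), 2 ≤ n → 0 < ε → ε ≤ 1 →
        (∀ ω : ℕ → ℕ, (∀ i, ω i ≤ n) →
          ∃ (s : MState) (H : Histogram),
            learner.Runs [n, ⌈1 / ε⌉₊] ω s ∧
            (s.drawn : ℝ) ≤ C * Real.log n * (1 / ε) ^ c ∧
            (s.bitOps : ℝ) ≤ C * Real.log n ^ 2 * (1 / ε) ^ c ∧
            s.out = H.encode ∧ H.IsOver n ∧
            (H.bins.length : ℝ) ≤ C * Real.log n * (1 / ε) ^ c ∧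
            H.SampledBy n sampler (C * Real.log (n / ε)) (C * (Real.log n + 1 / ε) ^ c)) ∧
        ∀ p : Fin n → unitInterval,
          9 / 10 ≤ (sampleLaw p).real
            {ω : ℕ → ℕ | ∃ (s : MState) (H : Histogram),
              learner.Runs [n, ⌈1 / ε⌉₊] ω s ∧ s.out = H.encode ∧
              H.tvDist n (sumOfBernoullis p) ≤ ε} := by
  obtain ⟨learner, sampler, C, c, h⟩ := theorem5_general
  exact ⟨learner, sampler, C, c, fun n ε hn hε hε1 => (h n ε hn hε hε1).imp_right fun hμ p =>
    hμ _ (sumOfBernoullis_ae_le p) (sumOfBernoullis_logConcave p)⟩
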